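/- **Setting.** A non-stationary latent bandit has a finite set of arms $\mathcal A$, a measurable space of contexts $\mathcal X$ and a finite set of latent states $\mathcal S$. The latent states form a Markov chain with initial distribution $P_1$ and transition matrix $P(s'\mid s;\phi_*)$. In round $t$ the agent observes a context $X_t$, chooses an arm $A_t$ and receives a reward $R_t\sim P(\cdot\mid A_t,X_t,S_t;\theta_*)$. Write $\mathcal H_t=(X_1,A_1,R_1,\dots,X_{t-1},A_{t-1},R_{t-1})$ for the history and $\mu(a,x,s)$ for the mean of $P(\cdot\mid a,x,s;\theta_*)$. The context $X_t$ may be generated by an arbitrary process: its conditional law may depend on $t$ and on $\mathcal H_t$, but given $\mathcal H_t$ it does not depend on the latent states. Actions do not influence the latent states. Assume, for constants $\sigma\ge 0$ and $b$: * the rewards are $\sigma^2$-sub-Gaussian: $\mathbb E_{R\sim P(\cdot\mid a,x,s;\theta_*)}\, e^{\lambda(R-\mu(a,x,s))}\le e^{\sigma^2\lambda^2/2}$ for all $a,x,s$ and all $\lambda>0$; * in each context, the mean rewards lie in an interval of length at most $b$: $\mu(a,x,s)-\mu(a',x,s')\le b$ for all $x,a,a',s,s'$. **Algorithm.** The model $\theta_*,\phi_*$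 and $P_1$ are known. Model-based Thompson sampling (mTS) samples in round $t$ a latent state $B_t\sim P_t$, plays $A_t=\arg\max_{a}\mu(a,X_t,B_t)$ (ties broken by a fixed measurable rule), observes $R_t$, and updates $$P_{t+1}(s')\;\propto\;\sum_{s\in\mathcal S}P_t(s)\,P(s'\mid s;\phi_*)\,P(R_t\mid A_t,X_t,s;\theta_*),$$ where $P(r\mid a,x,s;\theta_*)$ denotes the likelihood, i.e. the density of the reward distribution with respect to a reference measure that is common to all latent states (it may depend on $a,x$). **Regret.** For a fixed latent state sequence $s_{1:n}$ the expected regret is $\mathcal R(n;\theta_*,s_{1:n})=\mathbb E\sum_{t=1}^n\bigl(\max_a\mu(a,X_t,s_t)-\mu(A_t,X_t,s_t)\bigr)$, and the $n$-round Bayes regret with fixed model is $\mathcal{BR}(n;\theta_*,\phi_*)=\mathbb E_{S_{1:n}\sim\phi_*}[\mathcal R(n;\theta_*,S_{1:n})]$. **Theorem.** Let $p=1-\min_{s\in\mathcal S}P(s\mid s;\phi_*)$ and $\tilde L=1+pn$. Then the $n$-round Bayes regret of mTS is $O\bigl(n^{2/3}\sqrt{|\mathcal S|\,\tilde L\,\log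 n}\bigr)$. That is, there is a constant $C>0$ that depends only on $\sigma$ and $b$ such that for every bandit as above and every $n\ge 2$ $$\mathcal{BR}(n;\theta_*,\phi_*)\;\le\; C\,n^{2/3}\sqrt{|\mathcal S|\,\tilde L\,\log n}.$$ -/

import Mathlib

open MeasureTheory ProbabilityTheory
open scoped NNReal ENNReal

/-- The history `H_t = (X_1, A_1, R_1, …, X_t, A_t, R_t)` of `t` completed rounds, each recorded as
(context, action, reward). Rounds are indexed from `0`. -/
abbrev History (A X : Type*) (t : ℕ) : Type _ := Fin t → X × A × ℝ

/-- Rescaling a nonnegative weight vector to a probability vector. Where the total weight is zero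
the given vector `d` is returned. -/
noncomputable def normalizeWeights {S : Type*} [Fintype S] (d w : S → ℝ≥0) : S → ℝ≥0 :=
  if ∑ s, w s = 0 then d else fun s => w s / ∑ s', w s'

/-- A non-stationary latent bandit with a fixed (known) model: finitely many arms `A`, contexts in a
measurable space `X`, and finitely many latent states `S`.

* `prior` is the distribution of the first latent state, `trans s s'` is the transition probability
  from `s` to `s'`;
* `reward (a, x, s)` is the conditional reward distribution;
* `context t` is the distribution of the context of round `t`; it may depend in an arbitrary way on
  the round and on everything observed before, but not on the latent states. -/
structure LatentBandit (A X S : Type*) [MeasurableSpace A] [MeasurableSpace X]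
    [Fintype S] [MeasurableSpace S] where
  prior : S → ℝ≥0
  sum_prior : ∑ s, prior s = 1
  trans : S → S → ℝ≥0
  sum_trans : ∀ s, ∑ s', trans s s' = 1
  context : (t : ℕ) → Kernel (History A X t) X
  isMarkov_context : ∀ t, IsMarkovKernel (context t)
  reward : Kernel (A × X × S) ℝ
  isMarkov_reward : IsMarkovKernel reward

attribute [instance] LatentBandit.isMarkov_context LatentBandit.isMarkov_reward

/-- A (randomized) policy: in round `t` it maps the history and the current context to a
distribution over actions. -/
structure Policy (A X : Type*) [MeasurableSpace A] [MeasurableSpace X] where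
  kernel : (t : ℕ) → Kernel (History A X t × X) A
  isMarkov_kernel : ∀ t, IsMarkovKernel (kernel t)

attribute [instance] Policy.isMarkov_kernel

theorem measurable_history_snoc {A X : Type*} [MeasurableSpace A] [MeasurableSpace X] (t : ℕ) :
    Measurable (fun p : History A X t × (X × A × ℝ) =>
      (Fin.snoc (α := fun _ => X × A × ℝ) p.1 p.2 : History A X (t + 1))) := by
  refine measurable_pi_lambda _ fun i => ?_
  refine Fin.lastCases ?_ (fun j => ?_) i
  · simpa using measurable_snd
  · simp only [Fin.snoc_castSucc]
    exact (measurable_pi_apply j).comp measurable_fst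

namespace LatentBandit

variable {A X S : Type*} [MeasurableSpace A] [MeasurableSpace X]
  [Fintype S] [MeasurableSpace S]

/-- The mean reward `μ(a, x, s)`. -/
noncomputable def mean (M : LatentBandit A X S) (a : A) (x : X) (s : S) : ℝ :=
  ∫ r, r ∂(M.reward (a, x, s))

/-- Rewards are integrable and `σ²`-sub-Gaussian around their mean. -/
def SubGaussianRewards (M : LatentBandit A X S) (σ : ℝ) : Prop :=
  ∀ a x s, Integrable (fun r : ℝ => r) (M.reward (a, x, s)) ∧
    ∀ l : ℝ, 0 < l →
      Integrable (fun r => Real.exp (l * (r - M.mean a x s))) (M.reward (a, x, s)) ∧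
      ∫ r, Real.exp (l * (r - M.mean a x s)) ∂(M.reward (a, x, s)) ≤ Real.exp (σ ^ 2 * l ^ 2 / 2)

/-- `p = 1 - min_s P(s | s)`, the maximal probability of a change of the latent state. -/
noncomputable def changeProb (M : LatentBandit A X S) : ℝ := 1 - ⨅ s, (M.trans s s : ℝ)

/-! ### The interaction -/

/-- One round in latent state `s` under the policy `π`, given the history: the context is drawn,
then the action is drawn from the policy, then the reward is drawn. -/
noncomputable def step (M : LatentBandit A X S) (π : Policy A X) (t : ℕ) (s : S) :
    Kernel (History A X t) (X × A × ℝ) :=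
  M.context t ⊗ₖ (π.kernel t ⊗ₖ
    M.reward.comap (fun q : (History A X t × X) × A => (q.2, q.1.2, s))
      (by fun_prop))

instance (M : LatentBandit A X S) (π : Policy A X) (t : ℕ) (s : S) :
    IsMarkovKernel (M.step π t s) := by unfold step; infer_instance

/-- The law of the history of the first `t` rounds under the policy `π`, for a fixed sequence of
latent states. -/
noncomputable def historyLaw (M : LatentBandit A X S) (π : Policy A X) :
    (t : ℕ) → (Fin t → S) → Measure (History A X t)
  | 0, _ => Measure.dirac (fun i => i.elim0)
  | t + 1, s =>
      (M.historyLaw π t (Fin.init s) ⊗ₘ M.step π t (s (Fin.last t))).map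
        (fun p => Fin.snoc (α := fun _ => X × A × ℝ) p.1 p.2)

instance isProbabilityMeasure_historyLaw (M : LatentBandit A X S) (π : Policy A X) (t : ℕ)
    (s : Fin t → S) : IsProbabilityMeasure (M.historyLaw π t s) := by
  induction t with
  | zero => unfold historyLaw; infer_instance
  | succ t ih =>
    have := ih (Fin.init s)
    unfold historyLaw
    exact Measure.isProbabilityMeasure_map (measurable_history_snoc t).aemeasurable

/-- The expected `n`-round regret of `π` for a fixed sequence `s` of latent states:
`E ∑_t (max_a μ(a, X_t, s_t) - μ(A_t, X_t, s_t))`. -/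
noncomputable def regret (M : LatentBandit A X S) (π : Policy A X) (n : ℕ) (s : Fin n → S) : ℝ :=
  ∫ h, ∑ t, ((⨆ a, M.mean a (h t).1 (s t)) - M.mean (h t).2.1 (h t).1 (s t))
    ∂(M.historyLaw π n s)

/-- The probability that the Markov chain of latent states runs through the sequence `s`. -/
noncomputable def pathProb (M : LatentBandit A X S) : (n : ℕ) → (Fin n → S) → ℝ≥0
  | 0, _ => 1
  | n + 1, s => M.prior (s 0) * ∏ i : Fin n, M.trans (s i.castSucc) (s i.succ)

/-- The `n`-round Bayes regret with fixed model: the expectation of the regret over the latent state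
sequence drawn from the Markov chain. -/
noncomputable def bayesRegret (M : LatentBandit A X S) (π : Policy A X) (n : ℕ) : ℝ :=
  ∑ s : Fin n → S, (M.pathProb n s : ℝ) * M.regret π n s

/-! ### Model-based Thompson sampling -/

/-- A likelihood function `lik a x s r = P(r | a, x, s)` of the reward model: for each arm and
context, densities of the reward distributions of all the latent states with respect to a
common measure `ref a x`. -/
structure Likelihood (M : LatentBandit A X S) where
  ref : A → X → Measure ℝ
  lik : A → X → S → ℝ → ℝ≥0
  measurable_lik : ∀ s, Measurable (fun q : X × A × ℝ => lik q.2.1 q.1 s q.2.2)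
  reward_eq : ∀ a x s,
    M.reward (a, x, s) = (ref a x).withDensity (fun r => (lik a x s r : ℝ≥0∞))

/-- Every model has a likelihood function (take the sum of the reward distributions of all the
latent states as reference measure), so that quantifying over one is no restriction. -/
theorem nonempty_likelihood [DiscreteMeasurableSpace S] (M : LatentBandit A X S) :
    Nonempty M.Likelihood := by
  let κ : S → Kernel (X × A) ℝ := fun s =>
    M.reward.comap (fun q : X × A => (q.2, q.1, s)) (by fun_prop)
  let η : Kernel (X × A) ℝ := ∑ s, κ s
  have hη : ∀ q, η q = ∑ s, κ s q := fun q => by simp [η]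
  have : ∀ s, IsFiniteKernel (κ s) := fun s => by
    have : IsMarkovKernel (κ s) := by
      change IsMarkovKernel (M.reward.comap _ _); infer_instance
    infer_instance
  have hfin : IsFiniteKernel η := by
    refine ⟨⟨∑ s, (κ s).bound, ENNReal.sum_lt_top.2 fun s _ => (κ s).bound_lt_top, fun q => ?_⟩⟩
    rw [hη, Measure.coe_finsetSum, Finset.sum_apply]
    exact Finset.sum_le_sum fun s _ => Kernel.measure_le_bound (κ s) q _
  have hac : ∀ s q, κ s q ≪ η q := fun s q => by
    refine Measure.absolutelyContinuous_of_le ?_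
    rw [hη]
    exact Finset.single_le_sum (f := fun s => κ s q) (fun _ _ => Measure.zero_le _)
      (Finset.mem_univ s)
  refine ⟨⟨fun a x => η (x, a), fun a x s r => (Kernel.rnDeriv (κ s) η (x, a) r).toNNReal,
    fun s => ?_, fun a x s => ?_⟩⟩
  · exact ((Kernel.measurable_rnDeriv (κ s) η).comp
      (by fun_prop : Measurable fun q : X × A × ℝ => ((q.1, q.2.1), q.2.2))).ennreal_toNNReal
  · have h1 : η.withDensity (Kernel.rnDeriv (κ s) η) (x, a) = κ s (x, a) :=
      Kernel.withDensity_rnDeriv_eq (hac s (x, a))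
    rw [Kernel.withDensity_apply _ (Kernel.measurable_rnDeriv (κ s) η)] at h1
    have h2 : κ s (x, a) = M.reward (a, x, s) := by simp [κ, Kernel.comap_apply]
    rw [← h2, ← h1]
    refine withDensity_congr_ae ?_
    filter_upwards [Kernel.rnDeriv_lt_top (κ s) η (a := (x, a))] with r hr
    exact (ENNReal.coe_toNNReal hr.ne).symm

/-- A measurable choice of a maximizer of `a ↦ μ(a, x, s)`. -/
structure GreedyRule (M : LatentBandit A X S) where
  act : X → S → A
  measurable_act : ∀ s, Measurable (fun x => act x s)
  mean_le : ∀ x s a, M.mean a x s ≤ M.mean (act x s) x s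

/-- The filtering distribution `P_t` computed by the algorithm: `P_1` is the prior, and
`P_{t+1}(s') ∝ ∑ s, P_t(s) P(s' | s) P(R_t | A_t, X_t, s)`. -/
noncomputable def belief (M : LatentBandit A X S) (ℓ : M.Likelihood) :
    (t : ℕ) → History A X t → S → ℝ≥0
  | 0, _ => M.prior
  | t + 1, h =>
      normalizeWeights M.prior fun s' =>
        ∑ s, M.belief ℓ t (Fin.init h) s * M.trans s s' *
          ℓ.lik (h (Fin.last t)).2.1 (h (Fin.last t)).1 s (h (Fin.last t)).2.2

theorem sum_belief (M : LatentBandit A X S) (ℓ : M.Likelihood) (t : ℕ) (h : History A X t) :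
    ∑ s, M.belief ℓ t h s = 1 := by
  cases t with
  | zero => exact M.sum_prior
  | succ t =>
    simp only [belief, normalizeWeights]
    split_ifs with h0
    · exact M.sum_prior
    · rw [← Finset.sum_div, div_self h0]

theorem measurable_belief (M : LatentBandit A X S) (ℓ : M.Likelihood) (t : ℕ) (s : S) :
    Measurable (fun h : History A X t => M.belief ℓ t h s) := by
  induction t generalizing s with
  | zero => exact measurable_const
  | succ t ih =>
    have hinit : Measurable (fun h : History A X (t + 1) => (Fin.init h : History A X t)) :=
      measurable_pi_lambda _ fun i => measurable_pi_apply _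
    have hw : ∀ s', Measurable (fun h : History A X (t + 1) =>
        ∑ s, M.belief ℓ t (Fin.init h) s * M.trans s s' *
          ℓ.lik (h (Fin.last t)).2.1 (h (Fin.last t)).1 s (h (Fin.last t)).2.2) := fun s' =>
      Finset.measurable_sum _ fun s _ =>
        (((ih s).comp hinit).mul_const _).mul
          ((ℓ.measurable_lik s).comp (measurable_pi_apply (Fin.last t)))
    have hsum := Finset.measurable_sum Finset.univ fun s' (_ : s' ∈ Finset.univ) => hw s'
    simp only [belief, normalizeWeights, ite_apply]
    exact Measurable.ite (hsum (measurableSet_singleton 0)) measurable_const ((hw s).div hsum)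

/-- Model-based Thompson sampling: in round `t` draw a latent state `B_t` from `P_t` and play the
best arm of `B_t` in the current context. -/
noncomputable def mTS (M : LatentBandit A X S) (ℓ : M.Likelihood) (g : M.GreedyRule) :
    Policy A X where
  kernel t :=
    { toFun := fun p => ∑ b, (M.belief ℓ t p.1 b : ℝ≥0∞) • Measure.dirac (g.act p.2 b)
      measurable' := by
        refine Measure.measurable_of_measurable_coe _ fun E hE => ?_
        simp only [Measure.coe_finsetSum, Finset.sum_apply, Measure.smul_apply, smul_eq_mul,
          Measure.dirac_apply' _ hE]
        refine Finset.measurable_sum _ fun b _ => Measurable.mul ?_ ?_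
        · exact ((M.measurable_belief ℓ t b).comp measurable_fst).coe_nnreal_ennreal
        · exact (measurable_one.indicator hE).comp ((g.measurable_act b).comp measurable_snd) }
  isMarkov_kernel t := ⟨fun p => ⟨by
    simp only [Kernel.coe_mk, Measure.coe_finsetSum, Finset.sum_apply, Measure.smul_apply,
      smul_eq_mul, measure_univ, mul_one]
    exact_mod_cast M.sum_belief ℓ t p.1⟩⟩

end LatentBandit

/-! The argument weighs regret against information and gives the sharper rate `√n`; the exponent 2/3
enters only at the end.

Since the model is known, `belief` is the exact posterior of the current latent state
(`lintegral_joint_eq`). Hence, given history and context, the true state and the sampled state are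
i.i.d. with law `p` (`roundMean_mTS`), and the expected regret of a round is `∑ u, p u * (m u u - c
u)`: here `m u v` is the mean in state `u` of the arm greedy for `v`, and `c v` is the posterior
average of `m · v`. By the arithmetic-geometric inequality each summand costs at most `1 / (2α)`
plus `α / 2` times a diagonal term of the expected squared surplus (`sum_sum_gap_le`). So a round
costs `|S| / (2α)` plus a multiple of its gain, the squared surplus over `2V`.

The total gain is bounded by coding. For each fixed path `s`, the product of the factors `tilt` is a
supermartingale under the marginal law of the history, so it has expectation at most 1
(`lintegral_cumProd_mixture_le`). That law dominates `P(s)` times the law of the history given `s`.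
Up to centered noise, the logarithm of the product is the accumulated gain. Applying `1 + x ≤ exp x`
to this logarithm plus `log Q(s)` and averaging over paths bounds the expected gain by `∑ P(s) (-log
Q(s))`, for any positive probability weights `Q` on paths (`sum_roundMean_gain_le`).

Taking for `Q` the chain that redraws its state uniformly with probability `1/n` gives code length
`O((1 + p n) log n)` when `|S| ≤ n` (`code_length_le`). Optimizing `α` gives the rate; for `|S| > n`
the trivial bound `n b` suffices. -/

theorem sum_eq_sum_sum_snoc {S R : Type*} [Fintype S] [AddCommMonoid R] (n : ℕ)
    (F : (Fin (n + 1) → S) → R) :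
    ∑ s, F s = ∑ s : Fin n → S, ∑ u, F (Fin.snoc (α := fun _ => S) s u) := by
  rw [← (Fin.snocEquiv (fun _ : Fin (n + 1) => S)).sum_comp, Fintype.sum_prod_type,
    Finset.sum_comm]
  rfl

theorem sum_mul_lintegral {S Ω : Type*} [Fintype S] [MeasurableSpace Ω] {μ : Measure Ω} (c : S → ℝ≥0∞)
    {f : S → Ω → ℝ≥0∞} (hf : ∀ u, Measurable (f u)) :
    ∑ u, c u * ∫⁻ ω, f u ω ∂μ = ∫⁻ ω, ∑ u, c u * f u ω ∂μ := by
  rw [lintegral_finsetSum _ fun u _ => (hf u).const_mul _]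
  exact Finset.sum_congr rfl fun u _ => (lintegral_const_mul _ (hf u)).symm

/-- Nonnegative weights with total zero all vanish, so the default `d` is never seen once the
normalizer is multiplied back. -/
theorem normalizeWeights_mul_sum {S : Type*} [Fintype S] (d w : S → ℝ≥0) (u : S) :
    normalizeWeights d w u * ∑ v, w v = w u := by
  unfold normalizeWeights
  split_ifs with h
  · rw [h, mul_zero, Finset.sum_eq_zero_iff.1 h u (Finset.mem_univ u)]
  · rw [div_mul_cancel₀ _ h]

namespace LatentBandit

variable {A X S : Type*} [MeasurableSpace A] [MeasurableSpace X]
  [Fintype S] [MeasurableSpace S]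

/-! ### The law of the latent states -/

theorem pathProb_one (M : LatentBandit A X S) (s : Fin 1 → S) :
    M.pathProb 1 s = M.prior (s 0) := by
  simp [pathProb]

theorem pathProb_snoc_zero (M : LatentBandit A X S) (s : Fin 0 → S) (u : S) :
    M.pathProb (0 + 1) (Fin.snoc (α := fun _ => S) s u) = M.prior u := by
  exact (M.pathProb_one _).trans (congrArg _ rfl)

theorem pathProb_snoc (M : LatentBandit A X S) (n : ℕ) (s : Fin (n + 1) → S) (u : S) :
    M.pathProb (n + 2) (Fin.snoc (α := fun _ => S) s u) =
      M.pathProb (n + 1) s * M.trans (s (Fin.last n)) u := by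
  have h0 : (Fin.snoc (α := fun _ => S) s u : Fin (n + 2) → S) 0 = s 0 := by
    rw [← Fin.castSucc_zero, Fin.snoc_castSucc]
  have h1 : ∀ i : Fin n, (Fin.snoc (α := fun _ => S) s u : Fin (n + 2) → S) i.castSucc.succ =
      s i.succ := fun i => by rw [Fin.succ_castSucc, Fin.snoc_castSucc]
  simp only [pathProb, h0, Fin.prod_univ_castSucc, Fin.snoc_castSucc, h1, Fin.succ_last,
    Fin.snoc_last, mul_assoc]

theorem sum_pathProb_snoc (M : LatentBandit A X S) (n : ℕ) (s : Fin n → S) :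
    ∑ u, M.pathProb (n + 1) (Fin.snoc (α := fun _ => S) s u) = M.pathProb n s := by
  cases n with
  | zero => simp_rw [pathProb_snoc_zero, M.sum_prior, pathProb]
  | succ n => simp_rw [pathProb_snoc, ← Finset.mul_sum, M.sum_trans, mul_one]

theorem sum_pathProb (M : LatentBandit A X S) (n : ℕ) : ∑ s, M.pathProb n s = 1 := by
  induction n with
  | zero => simp [pathProb]
  | succ n ih => rw [sum_eq_sum_sum_snoc]; simp_rw [sum_pathProb_snoc, ih]

/-! ### Joint laws of history and latent state -/

/-- Joint law of the history of the first `t` rounds and the event that the latent state of the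
next round is `u`. -/
noncomputable def joint (M : LatentBandit A X S) (π : Policy A X) (t : ℕ) (u : S) :
    Measure (History A X t) :=
  ∑ s : Fin t → S, M.pathProb (t + 1) (Fin.snoc (α := fun _ => S) s u) • M.historyLaw π t s

/-- The law of the history of the first `t` rounds, averaged over the latent states. -/
noncomputable def mixture (M : LatentBandit A X S) (π : Policy A X) (t : ℕ) :
    Measure (History A X t) :=
  ∑ s : Fin t → S, M.pathProb t s • M.historyLaw π t s

theorem lintegral_joint (M : LatentBandit A X S) (π : Policy A X) (t : ℕ) (u : S)
    (F : History A X t → ℝ≥0∞) :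
    ∫⁻ h, F h ∂M.joint π t u = ∑ s : Fin t → S,
      (M.pathProb (t + 1) (Fin.snoc (α := fun _ => S) s u) : ℝ≥0∞) *
        ∫⁻ h, F h ∂M.historyLaw π t s := by
  simp only [joint, lintegral_finsetSum_measure, lintegral_smul_measure]
  rfl

theorem lintegral_mixture (M : LatentBandit A X S) (π : Policy A X) (t : ℕ)
    (F : History A X t → ℝ≥0∞) :
    ∫⁻ h, F h ∂M.mixture π t = ∑ s : Fin t → S,
      (M.pathProb t s : ℝ≥0∞) * ∫⁻ h, F h ∂M.historyLaw π t s := by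
  simp only [mixture, lintegral_finsetSum_measure, lintegral_smul_measure]
  rfl

theorem lintegral_mixture_eq_sum_joint (M : LatentBandit A X S) (π : Policy A X) (t : ℕ)
    (F : History A X t → ℝ≥0∞) :
    ∫⁻ h, F h ∂M.mixture π t = ∑ u, ∫⁻ h, F h ∂M.joint π t u := by
  simp_rw [lintegral_mixture, lintegral_joint]
  rw [Finset.sum_comm]
  refine Finset.sum_congr rfl fun s _ => ?_
  rw [← Finset.sum_mul, ← M.sum_pathProb_snoc t s, ENNReal.ofNNReal_finsetSum]

instance isProbabilityMeasure_mixture (M : LatentBandit A X S) (π : Policy A X) (t : ℕ) :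
    IsProbabilityMeasure (M.mixture π t) := by
  constructor
  rw [← lintegral_one, lintegral_mixture]
  simp only [lintegral_one, measure_univ, mul_one]
  exact_mod_cast M.sum_pathProb t

/-- Context and action of round `t`, given the history. -/
noncomputable def play (M : LatentBandit A X S) (π : Policy A X) (t : ℕ) :
    Kernel (History A X t) (X × A) := M.context t ⊗ₖ π.kernel t

instance (M : LatentBandit A X S) (π : Policy A X) (t : ℕ) :
    IsMarkovKernel (M.play π t) := by unfold play; infer_instance

theorem measurable_lintegral_reward (M : LatentBandit A X S) (u : S) {F : X × A × ℝ → ℝ≥0∞}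
    (hF : Measurable F) :
    Measurable fun q : X × A => ∫⁻ r, F (q.1, q.2, r) ∂M.reward (q.2, q.1, u) := by
  have : Measurable fun p : (X × A) × ℝ => F (p.1.1, p.1.2, p.2) := hF.comp (by fun_prop)
  exact this.lintegral_kernel_prod_right'
    (κ := M.reward.comap (fun q : X × A => (q.2, q.1, u)) (by fun_prop))

theorem lintegral_step (M : LatentBandit A X S) (π : Policy A X) (t : ℕ) (u : S)
    (h : History A X t) {F : X × A × ℝ → ℝ≥0∞} (hF : Measurable F) :
    ∫⁻ z, F z ∂M.step π t u h =
      ∫⁻ q, ∫⁻ r, F (q.1, q.2, r) ∂M.reward (q.2, q.1, u) ∂M.play π t h := by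
  unfold step play
  rw [Kernel.lintegral_compProd _ _ _ hF, Kernel.lintegral_compProd _ _ _ (M.measurable_lintegral_reward u hF)]
  refine lintegral_congr fun x => ?_
  rw [Kernel.lintegral_compProd _ _ _ (f := fun p => F (x, p)) (hF.comp measurable_prodMk_left)]
  rfl

theorem lintegral_historyLaw_succ (M : LatentBandit A X S) (π : Policy A X) (t : ℕ)
    (s : Fin (t + 1) → S) {F : History A X (t + 1) → ℝ≥0∞} (hF : Measurable F) :
    ∫⁻ h, F h ∂M.historyLaw π (t + 1) s =
      ∫⁻ h, ∫⁻ z, F (Fin.snoc (α := fun _ => X × A × ℝ) h z) ∂M.step π t (s (Fin.last t)) h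
        ∂M.historyLaw π t (Fin.init s) := by
  rw [historyLaw, lintegral_map hF (measurable_history_snoc t),
    Measure.lintegral_compProd
    (f := fun p => F (Fin.snoc (α := fun _ => X × A × ℝ) p.1 p.2))
    (hF.comp (measurable_history_snoc t))]

theorem measurable_lintegral_step (M : LatentBandit A X S) (π : Policy A X) (t : ℕ) (u : S)
    {F : History A X t × (X × A × ℝ) → ℝ≥0∞} (hF : Measurable F) :
    Measurable fun h => ∫⁻ z, F (h, z) ∂M.step π t u h :=
  hF.lintegral_kernel_prod_right'

/-- The forward recursion of the unnormalized filter: play a round in the current state `v`, then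
move to `u`. Outcomes do not influence the transition. -/
theorem lintegral_joint_succ (M : LatentBandit A X S) (π : Policy A X) (t : ℕ) (u : S)
    {F : History A X (t + 1) → ℝ≥0∞} (hF : Measurable F) :
    ∫⁻ h, F h ∂M.joint π (t + 1) u = ∑ v, (M.trans v u : ℝ≥0∞) *
      ∫⁻ h, ∫⁻ z, F (Fin.snoc (α := fun _ => X × A × ℝ) h z) ∂M.step π t v h
        ∂M.joint π t v := by
  simp_rw [lintegral_joint, lintegral_historyLaw_succ _ _ _ _ hF, sum_eq_sum_sum_snoc,
    pathProb_snoc, Fin.init_snoc, Fin.snoc_last, Finset.mul_sum]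
  rw [Finset.sum_comm]
  refine Finset.sum_congr rfl fun v _ => Finset.sum_congr rfl fun s _ => ?_
  push_cast
  ring

/-- The first `t` rounds depend only on the first `t` states, so the last state of a path of length
`t + 1` is the pending state recorded by `joint`. -/
theorem sum_pathProb_mul_lintegral (M : LatentBandit A X S) (π : Policy A X) (t : ℕ)
    (F : S → History A X t → ℝ≥0∞) :
    ∑ s : Fin (t + 1) → S, (M.pathProb (t + 1) s : ℝ≥0∞) *
      ∫⁻ h, F (s (Fin.last t)) h ∂M.historyLaw π t (Fin.init s) =
    ∑ u, ∫⁻ h, F u h ∂M.joint π t u := by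
  simp_rw [lintegral_joint, sum_eq_sum_sum_snoc, Fin.init_snoc, Fin.snoc_last]
  rw [Finset.sum_comm]

theorem lintegral_mixture_succ (M : LatentBandit A X S) (π : Policy A X) (t : ℕ)
    {F : History A X (t + 1) → ℝ≥0∞} (hF : Measurable F) :
    ∫⁻ h, F h ∂M.mixture π (t + 1) =
      ∑ u, ∫⁻ h, ∫⁻ z, F (Fin.snoc (α := fun _ => X × A × ℝ) h z) ∂M.step π t u h
        ∂M.joint π t u := by
  simp_rw [lintegral_mixture, lintegral_historyLaw_succ _ _ _ _ hF]
  exact M.sum_pathProb_mul_lintegral π t fun u h =>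
    ∫⁻ z, F (Fin.snoc (α := fun _ => X × A × ℝ) h z) ∂M.step π t u h

/-! ### The belief is the posterior distribution of the latent state -/

theorem lintegral_reward (M : LatentBandit A X S) (ℓ : M.Likelihood) (a : A) (x : X) (u : S)
    {F : ℝ → ℝ≥0∞} (hF : Measurable F) :
    ∫⁻ r, F r ∂M.reward (a, x, u) = ∫⁻ r, ℓ.lik a x u r * F r ∂ℓ.ref a x := by
  have hl : Measurable fun r => (ℓ.lik a x u r : ℝ≥0∞) :=
    ((ℓ.measurable_lik u).comp (by fun_prop : Measurable fun r : ℝ => (x, a, r))).coe_nnreal_ennreal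
  rw [ℓ.reward_eq, lintegral_withDensity_eq_lintegral_mul _ hl hF]
  rfl

/-- Bayes' rule for one observed reward. -/
theorem sum_lintegral_reward_eq (M : LatentBandit A X S) (ℓ : M.Likelihood) (a : A) (x : X)
    (d p : S → ℝ≥0) (u : S) {F : ℝ → ℝ≥0∞} (hF : Measurable F) :
    ∑ v, (p v : ℝ≥0∞) * ((M.trans v u : ℝ≥0∞) * ∫⁻ r, F r ∂M.reward (a, x, v)) =
    ∑ v, (p v : ℝ≥0∞) * ∫⁻ r, (normalizeWeights d
      (fun u' => ∑ w, p w * M.trans w u' * ℓ.lik a x w r) u : ℝ≥0∞) * F r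
        ∂M.reward (a, x, v) := by
  have hl : ∀ v, Measurable fun r => ℓ.lik a x v r := fun v =>
    (ℓ.measurable_lik v).comp (by fun_prop : Measurable fun r : ℝ => (x, a, r))
  have hw : ∀ u', Measurable fun r => ∑ w, p w * M.trans w u' * ℓ.lik a x w r := fun u' =>
    Finset.measurable_sum _ fun w _ => (hl w).const_mul _
  have hn : Measurable fun r => normalizeWeights d
      (fun u' => ∑ w, p w * M.trans w u' * ℓ.lik a x w r) u := by
    have hsum := Finset.measurable_sum Finset.univ fun s' (_ : s' ∈ Finset.univ) => hw s'
    simp only [normalizeWeights, ite_apply]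
    exact Measurable.ite (hsum (measurableSet_singleton 0)) measurable_const ((hw u).div hsum)
  -- The rows of the transition matrix sum to one, so the normalizer is the predictive density of
  -- the reward.
  have hW : ∀ r, ∑ u', ∑ w, p w * M.trans w u' * ℓ.lik a x w r = ∑ w, p w * ℓ.lik a x w r := by
    intro r
    rw [Finset.sum_comm]
    refine Finset.sum_congr rfl fun w _ => ?_
    rw [← Finset.sum_mul, ← Finset.mul_sum, M.sum_trans, mul_one]
  have hnF : Measurable fun r => (normalizeWeights d
      (fun u' => ∑ w, p w * M.trans w u' * ℓ.lik a x w r) u : ℝ≥0∞) * F r :=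
    hn.coe_nnreal_ennreal.mul hF
  simp_rw [M.lintegral_reward ℓ _ _ _ hF, M.lintegral_reward ℓ _ _ _ hnF]
  have e1 : ∀ v, (p v : ℝ≥0∞) * ((M.trans v u : ℝ≥0∞) *
      ∫⁻ r, ℓ.lik a x v r * F r ∂ℓ.ref a x) =
      ∫⁻ r, (p v * M.trans v u * ℓ.lik a x v r : ℝ≥0) * F r ∂ℓ.ref a x := fun v => by
    have := hl v
    rw [← lintegral_const_mul, ← lintegral_const_mul]
    · refine lintegral_congr fun r => ?_
      push_cast; ring
    all_goals fun_prop
  have e2 : ∀ v, (p v : ℝ≥0∞) * ∫⁻ r, ℓ.lik a x v r * ((normalizeWeights d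
      (fun u' => ∑ w, p w * M.trans w u' * ℓ.lik a x w r) u : ℝ≥0∞) * F r) ∂ℓ.ref a x =
      ∫⁻ r, (normalizeWeights d (fun u' => ∑ w, p w * M.trans w u' * ℓ.lik a x w r) u *
        (p v * ℓ.lik a x v r) : ℝ≥0) * F r ∂ℓ.ref a x := fun v => by
    have := hl v
    rw [← lintegral_const_mul]
    · refine lintegral_congr fun r => ?_
      push_cast; ring
    · fun_prop
  simp_rw [e1, e2]
  rw [← lintegral_finsetSum, ← lintegral_finsetSum]
  · refine lintegral_congr fun r => ?_
    rw [← Finset.sum_mul, ← Finset.sum_mul]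
    congr 1
    norm_cast
    -- The predictive density on the right is exactly the normalizer of the updated belief and
    -- cancels it.
    rw [← Finset.mul_sum, ← hW, normalizeWeights_mul_sum]
  all_goals
    intro v _
    have := hl v
    fun_prop

/-- The filtering distribution is the conditional law of the latent state given the history. -/
theorem lintegral_joint_eq (M : LatentBandit A X S) (ℓ : M.Likelihood) (π : Policy A X) (t : ℕ)
    (u : S) {F : History A X t → ℝ≥0∞} (hF : Measurable F) :
    ∫⁻ h, F h ∂M.joint π t u = ∫⁻ h, M.belief ℓ t h u * F h ∂M.mixture π t := by
  induction t generalizing u with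
  | zero =>
    -- There is only one history of zero rounds, so `F` is constant and the prior factors out.
    have hF' : F = fun _ => F fun i => i.elim0 := by
      funext h; congr 1; funext i; exact i.elim0
    rw [hF']
    rw [lintegral_joint, lintegral_mixture]
    simp only [belief, lintegral_const, measure_univ, pathProb_snoc_zero]
    simp [pathProb]
  | succ t ih =>
    have hb := (M.measurable_belief ℓ (t + 1) u).coe_nnreal_ennreal
    have hbF : Measurable fun h => (M.belief ℓ (t + 1) h u : ℝ≥0∞) * F h := hb.mul hF
    rw [lintegral_joint_succ _ _ _ _ hF, lintegral_mixture_succ _ _ _ hbF]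
    have hm1 : ∀ v, Measurable fun h => ∫⁻ z, F (Fin.snoc (α := fun _ => X × A × ℝ) h z)
        ∂M.step π t v h := fun v =>
      M.measurable_lintegral_step π t v (hF.comp (measurable_history_snoc t))
    have hm2 : ∀ v, Measurable fun h => ∫⁻ z,
        M.belief ℓ (t + 1) (Fin.snoc (α := fun _ => X × A × ℝ) h z) u *
        F (Fin.snoc (α := fun _ => X × A × ℝ) h z) ∂M.step π t v h := fun v =>
      M.measurable_lintegral_step π t v (hbF.comp (measurable_history_snoc t))
    have hp : ∀ v, Measurable fun h => (M.belief ℓ t h v : ℝ≥0∞) := fun v =>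
      (M.measurable_belief ℓ t v).coe_nnreal_ennreal
    simp_rw [fun v => ih v (hm1 v), fun v => ih v (hm2 v)]
    rw [sum_mul_lintegral, ← lintegral_finsetSum]
    rotate_left
    · exact fun v _ => (hp v).mul (hm2 v)
    · exact fun v => (hp v).mul (hm1 v)
    refine lintegral_congr fun h => ?_
    have hs : Measurable fun z : X × A × ℝ =>
        (Fin.snoc (α := fun _ => X × A × ℝ) h z : History A X (t + 1)) :=
      (measurable_history_snoc t).comp measurable_prodMk_left
    have e1 := fun v => M.lintegral_step π t v h (hF.comp hs)
    have e2 := fun v => M.lintegral_step π t v h (hbF.comp hs)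
    have hr1 := fun v => M.measurable_lintegral_reward v (hF.comp hs)
    have hr2 := fun v => M.measurable_lintegral_reward v (hbF.comp hs)
    simp only [Function.comp_def] at e1 e2 hr1 hr2
    simp_rw [e1, e2]
    simp_rw [← mul_assoc]
    rw [sum_mul_lintegral _ hr1, sum_mul_lintegral _ hr2]
    refine lintegral_congr fun q => ?_
    have := M.sum_lintegral_reward_eq ℓ q.2 q.1 M.prior (M.belief ℓ t h) u
      (hF.comp (hs.comp (by fun_prop : Measurable fun r : ℝ => (q.1, q.2, r))))
    simp only [Function.comp_def] at this
    simp_rw [mul_comm (M.trans _ u : ℝ≥0∞), mul_assoc, this, belief, Fin.init_snoc, Fin.snoc_last]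

end LatentBandit

/-! ### Two scalar inequalities -/

/-- Under a centered law the linear term vanishes, leaving a bound of the form `exp (y ^ 2)`. For
`|y| ≤ 1` it follows from `exp y ≤ 1 + y + y ^ 2`; beyond that range the sign of `y` decides. -/
theorem Real.exp_le_add_exp_sq (y : ℝ) : Real.exp y ≤ y + Real.exp (y ^ 2) := by
  rcases le_or_gt |y| 1 with h | h
  · have h1 := (abs_le.1 (Real.abs_exp_sub_one_sub_id_le h)).2
    have h2 := Real.add_one_le_exp (y ^ 2)
    linarith
  · rcases lt_abs.1 h with h | h
    · have : Real.exp y ≤ Real.exp (y ^ 2) := Real.exp_le_exp.2 (by nlinarith)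
      linarith
    · have h1 : Real.exp y ≤ 1 := Real.exp_le_one_iff.2 (by linarith)
      have h2 := Real.add_one_le_exp (y ^ 2)
      nlinarith

/-- The exponential moments of a centered finitely supported distribution of diameter at most
`b`. -/
theorem sum_mul_exp_le {S : Type*} [Fintype S] (p : S → ℝ≥0) (hp : ∑ u, p u = 1) (m : S → ℝ)
    {b : ℝ} (hm : ∀ u v, m u - m v ≤ b) (l : ℝ) :
    ∑ u, (p u : ℝ) * Real.exp (l * (m u - ∑ v, (p v : ℝ) * m v)) ≤ Real.exp (l ^ 2 * b ^ 2) := by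
  have hp' : ∑ u, (p u : ℝ) = 1 := by exact_mod_cast hp
  set c := ∑ v, (p v : ℝ) * m v with hc
  have h1 : ∀ u, m u - c ≤ b := fun u => by
    have : m u - c = ∑ v, (p v : ℝ) * (m u - m v) := by
      simp_rw [mul_sub, Finset.sum_sub_distrib, ← Finset.sum_mul, hp', one_mul, hc]
    rw [this]
    calc _ ≤ ∑ v, (p v : ℝ) * b :=
          Finset.sum_le_sum fun v _ => mul_le_mul_of_nonneg_left (hm u v) (p v).2
      _ = b := by rw [← Finset.sum_mul, hp', one_mul]
  have h2 : ∀ u, -b ≤ m u - c := fun u => by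
    have : m u - c = ∑ v, (p v : ℝ) * (m u - m v) := by
      simp_rw [mul_sub, Finset.sum_sub_distrib, ← Finset.sum_mul, hp', one_mul, hc]
    rw [this]
    calc -b = ∑ v, (p v : ℝ) * (-b) := by rw [← Finset.sum_mul, hp', one_mul]
      _ ≤ _ := Finset.sum_le_sum fun v _ =>
        mul_le_mul_of_nonneg_left (by linarith [hm v u]) (p v).2
  have h3 : ∀ u, (p u : ℝ) * Real.exp (l * (m u - c)) ≤
      p u * (l * (m u - c)) + p u * Real.exp (l ^ 2 * b ^ 2) := fun u => by
    rw [← mul_add]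
    refine mul_le_mul_of_nonneg_left ?_ (p u).2
    refine (Real.exp_le_add_exp_sq _).trans (add_le_add_right (Real.exp_le_exp.2 ?_) _)
    rw [mul_pow]
    exact mul_le_mul_of_nonneg_left (sq_le_sq' (h2 u) (h1 u)) (sq_nonneg l)
  refine (Finset.sum_le_sum fun u _ => h3 u).trans (le_of_eq ?_)
  rw [Finset.sum_add_distrib, ← Finset.sum_mul, hp', one_mul]
  have : ∑ u, (p u : ℝ) * (l * (m u - c)) = 0 := by
    have : ∀ u, (p u : ℝ) * (l * (m u - c)) = l * (p u * m u - p u * c) := fun u => by ring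
    simp_rw [this, ← Finset.mul_sum, Finset.sum_sub_distrib, ← Finset.sum_mul, hp', one_mul, ← hc,
      sub_self, mul_zero]
  rw [this, zero_add]

namespace LatentBandit

variable {A X S : Type*} [MeasurableSpace A] [MeasurableSpace X]

/-! ### Additive and multiplicative functionals of the history -/

/-- The sum over the rounds of a function of the latent state, the history and the outcome. -/
noncomputable def cumSum
    (f : (t : ℕ) → S → History A X t → X × A × ℝ → ℝ≥0∞) :
    (n : ℕ) → (Fin n → S) → History A X n → ℝ≥0∞
  | 0, _, _ => 0
  | n + 1, s, h => cumSum f n (Fin.init s) (Fin.init h) +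
      f n (s (Fin.last n)) (Fin.init h) (h (Fin.last n))

/-- The product over the rounds of a function of the latent state, the history and the outcome. -/
noncomputable def cumProd
    (f : (t : ℕ) → S → History A X t → X × A × ℝ → ℝ≥0∞) :
    (n : ℕ) → (Fin n → S) → History A X n → ℝ≥0∞
  | 0, _, _ => 1
  | n + 1, s, h => cumProd f n (Fin.init s) (Fin.init h) *
      f n (s (Fin.last n)) (Fin.init h) (h (Fin.last n))

theorem measurable_history_init (n : ℕ) :
    Measurable fun h : History A X (n + 1) => (Fin.init h : History A X n) :=
  measurable_pi_lambda _ fun _ => measurable_pi_apply _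

theorem measurable_cumSum {f : (t : ℕ) → S → History A X t → X × A × ℝ → ℝ≥0∞}
    (hf : ∀ t u, Measurable fun p : History A X t × (X × A × ℝ) => f t u p.1 p.2)
    (n : ℕ) (s : Fin n → S) : Measurable (cumSum f n s) := by
  induction n with
  | zero => exact measurable_const
  | succ n ih =>
    exact ((ih _).comp (measurable_history_init n)).add ((hf n (s (Fin.last n))).comp
      ((measurable_history_init n).prodMk (measurable_pi_apply (Fin.last n))))

theorem measurable_cumProd {f : (t : ℕ) → S → History A X t → X × A × ℝ → ℝ≥0∞}
    (hf : ∀ t u, Measurable fun p : History A X t × (X × A × ℝ) => f t u p.1 p.2)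
    (n : ℕ) (s : Fin n → S) : Measurable (cumProd f n s) := by
  induction n with
  | zero => exact measurable_const
  | succ n ih =>
    exact ((ih _).comp (measurable_history_init n)).mul ((hf n (s (Fin.last n))).comp
      ((measurable_history_init n).prodMk (measurable_pi_apply (Fin.last n))))

variable [Fintype S] [MeasurableSpace S]

/-- The expected contribution of round `t`. -/
noncomputable def roundMean (M : LatentBandit A X S) (π : Policy A X) (t : ℕ)
    (g : S → History A X t → X × A × ℝ → ℝ≥0∞) : ℝ≥0∞ :=
  ∑ u, ∫⁻ h, ∫⁻ z, g u h z ∂M.step π t u h ∂M.joint π t u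

/-- The expectation of a nonnegative additive functional decomposes over the rounds. -/
theorem sum_pathProb_mul_lintegral_cumSum (M : LatentBandit A X S) (π : Policy A X)
    {f : (t : ℕ) → S → History A X t → X × A × ℝ → ℝ≥0∞}
    (hf : ∀ t u, Measurable fun p : History A X t × (X × A × ℝ) => f t u p.1 p.2) (n : ℕ) :
    ∑ s, (M.pathProb n s : ℝ≥0∞) * ∫⁻ h, cumSum f n s h ∂M.historyLaw π n s =
      ∑ t ∈ Finset.range n, M.roundMean π t (f t) := by
  induction n with
  | zero => simp [cumSum]
  | succ n ih =>
    rw [Finset.sum_range_succ, ← ih]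
    have key : ∀ s : Fin (n + 1) → S,
        ∫⁻ h, cumSum f (n + 1) s h ∂M.historyLaw π (n + 1) s =
        ∫⁻ h, cumSum f n (Fin.init s) h ∂M.historyLaw π n (Fin.init s) +
        ∫⁻ h, ∫⁻ z, f n (s (Fin.last n)) h z ∂M.step π n (s (Fin.last n)) h
          ∂M.historyLaw π n (Fin.init s) := fun s => by
      rw [lintegral_historyLaw_succ _ _ _ _ (measurable_cumSum hf _ _),
        ← lintegral_add_left (measurable_cumSum hf _ _)]
      refine lintegral_congr fun h => ?_
      simp only [cumSum, Fin.init_snoc, Fin.snoc_last]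
      rw [lintegral_add_left measurable_const, lintegral_const, measure_univ, mul_one]
    simp_rw [key, mul_add, Finset.sum_add_distrib]
    congr 1
    · rw [sum_eq_sum_sum_snoc]
      refine Finset.sum_congr rfl fun s _ => ?_
      simp_rw [Fin.init_snoc]
      rw [← Finset.sum_mul, ← M.sum_pathProb_snoc n s, ENNReal.ofNNReal_finsetSum]
    · exact M.sum_pathProb_mul_lintegral π n fun u h => ∫⁻ z, f n u h z ∂M.step π n u h

/-- The path `s` only selects the factors, while the outcomes follow the marginal law. Given the
history, that law draws the state of the round from the belief, so `h1` says that each factor has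
conditional mean at most one. -/
theorem lintegral_cumProd_mixture_le (M : LatentBandit A X S) (ℓ : M.Likelihood) (π : Policy A X)
    {f : (t : ℕ) → S → History A X t → X × A × ℝ → ℝ≥0∞}
    (hf : ∀ t u, Measurable fun p : History A X t × (X × A × ℝ) => f t u p.1 p.2)
    (h1 : ∀ t v h, ∑ u, (M.belief ℓ t h u : ℝ≥0∞) * ∫⁻ z, f t v h z ∂M.step π t u h ≤ 1)
    (n : ℕ) (s : Fin n → S) :
    ∫⁻ h, cumProd f n s h ∂M.mixture π n ≤ 1 := by
  induction n with
  | zero => simp [cumProd]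
  | succ n ih =>
    have hm : ∀ u, Measurable fun h => ∫⁻ z, f n (s (Fin.last n)) h z ∂M.step π n u h := fun u =>
      M.measurable_lintegral_step π n u (hf n _)
    have hc := measurable_cumProd hf n (Fin.init s)
    have key : ∀ u h, ∫⁻ z, cumProd f (n + 1) s (Fin.snoc (α := fun _ => X × A × ℝ) h z)
        ∂M.step π n u h = cumProd f n (Fin.init s) h *
          ∫⁻ z, f n (s (Fin.last n)) h z ∂M.step π n u h := fun u h => by
      simp only [cumProd, Fin.init_snoc, Fin.snoc_last]
      exact lintegral_const_mul _ ((hf n _).comp measurable_prodMk_left)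
    rw [lintegral_mixture_succ _ _ _ (measurable_cumProd hf _ _)]
    have e : ∀ u, ∫⁻ h, cumProd f n (Fin.init s) h *
          ∫⁻ z, f n (s (Fin.last n)) h z ∂M.step π n u h ∂M.joint π n u =
        ∫⁻ h, M.belief ℓ n h u * (cumProd f n (Fin.init s) h *
          ∫⁻ z, f n (s (Fin.last n)) h z ∂M.step π n u h) ∂M.mixture π n := fun u =>
      M.lintegral_joint_eq ℓ π n u (hc.mul (hm u))
    simp_rw [key, e]
    have hb : ∀ u, Measurable fun h => (M.belief ℓ n h u : ℝ≥0∞) := fun u =>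
      (M.measurable_belief ℓ n u).coe_nnreal_ennreal
    rw [← lintegral_finsetSum]
    swap
    · exact fun u _ => (hb u).mul (hc.mul (hm u))
    refine le_trans (lintegral_mono fun h => ?_) (ih (Fin.init s))
    calc _ = cumProd f n (Fin.init s) h * ∑ u, (M.belief ℓ n h u : ℝ≥0∞) *
            ∫⁻ z, f n (s (Fin.last n)) h z ∂M.step π n u h := by
          rw [Finset.mul_sum]
          exact Finset.sum_congr rfl fun u _ => by ring
      _ ≤ _ := mul_le_of_le_one_right' (h1 n _ h)

end LatentBandit

namespace LatentBandit

variable {A X S : Type*} [MeasurableSpace A] [MeasurableSpace X]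
  [Fintype S] [MeasurableSpace S]

/-! ### Sub-Gaussian rewards -/

theorem measurable_mean (M : LatentBandit A X S) (u : S) :
    Measurable fun q : X × A => M.mean q.2 q.1 u :=
  (stronglyMeasurable_id.integral_kernel
    (κ := M.reward.comap (fun q : X × A => (q.2, q.1, u)) (by fun_prop))).measurable

theorem SubGaussianRewards.lintegral_exp_le {M : LatentBandit A X S} {σ : ℝ}
    (hM : M.SubGaussianRewards σ) (a : A) (x : X) (u : S) {l : ℝ} (hl : 0 ≤ l) :
    ∫⁻ r, ENNReal.ofReal (Real.exp (l * (r - M.mean a x u))) ∂M.reward (a, x, u) ≤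
      ENNReal.ofReal (Real.exp (σ ^ 2 * l ^ 2 / 2)) := by
  rcases hl.eq_or_lt with rfl | hl
  · simp
  · obtain ⟨h1, h2⟩ := (hM a x u).2 l hl
    rw [← ofReal_integral_eq_lintegral_ofReal h1 (ae_of_all _ fun r => (Real.exp_pos _).le)]
    exact ENNReal.ofReal_le_ofReal h2

theorem SubGaussianRewards.lintegral_pos_part_le {M : LatentBandit A X S} {σ : ℝ}
    (hM : M.SubGaussianRewards σ) (a : A) (x : X) (u : S) :
    ∫⁻ r, ENNReal.ofReal (r - M.mean a x u) ∂M.reward (a, x, u) ≤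
      ENNReal.ofReal (Real.exp (σ ^ 2 / 2)) := by
  have h := hM.lintegral_exp_le a x u zero_le_one
  simp only [one_mul, one_pow, mul_one] at h
  refine le_trans (lintegral_mono fun r => ENNReal.ofReal_le_ofReal ?_) h
  linarith [Real.add_one_le_exp (r - M.mean a x u)]

/-- A centered integrable variable has positive and negative parts of equal expectation. This form
lets the noise cancel among extended nonnegative integrals. -/
theorem SubGaussianRewards.lintegral_neg_part_eq {M : LatentBandit A X S} {σ : ℝ}
    (hM : M.SubGaussianRewards σ) (a : A) (x : X) (u : S) :
    ∫⁻ r, ENNReal.ofReal (M.mean a x u - r) ∂M.reward (a, x, u) =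
      ∫⁻ r, ENNReal.ofReal (r - M.mean a x u) ∂M.reward (a, x, u) := by
  have hi : Integrable (fun r => r - M.mean a x u) (M.reward (a, x, u)) :=
    (hM a x u).1.sub (integrable_const _)
  have h0 : ∫ r, (r - M.mean a x u) ∂M.reward (a, x, u) = 0 := by
    rw [integral_sub (hM a x u).1 (integrable_const _)]
    simp [mean]
  rw [integral_eq_lintegral_pos_part_sub_lintegral_neg_part hi, sub_eq_zero] at h0
  simp only [neg_sub] at h0
  refine ((ENNReal.toReal_eq_toReal_iff' ?_ ?_).1 h0).symm
  · exact ((hM.lintegral_pos_part_le a x u).trans_lt ENNReal.ofReal_lt_top).ne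
  · have := hi.neg.lintegral_lt_top
    simpa using this.ne

/-! ### Surplus of the mean reward over its prediction -/

variable (M : LatentBandit A X S) (ℓ : M.Likelihood)

/-- The mean reward predicted from the history. -/
noncomputable def predMean (t : ℕ) (h : History A X t) (x : X) (a : A) : ℝ :=
  ∑ u, (M.belief ℓ t h u : ℝ) * M.mean a x u

/-- The positive part of the difference between the mean reward in a latent state and its
prediction. -/
noncomputable def surplus (t : ℕ) (u : S) (h : History A X t) (x : X) (a : A) : ℝ :=
  max (M.mean a x u - M.predMean ℓ t h x a) 0

theorem surplus_nonneg (t : ℕ) (u : S) (h : History A X t) (x : X) (a : A) :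
    0 ≤ M.surplus ℓ t u h x a := le_max_right _ _

/-- This identity turns the drift of the tilt's linear term into a square; half of it survives the
quadratic correction as `gain`. -/
theorem surplus_mul (t : ℕ) (u : S) (h : History A X t) (x : X) (a : A) :
    M.surplus ℓ t u h x a * (M.mean a x u - M.predMean ℓ t h x a) =
      M.surplus ℓ t u h x a ^ 2 := by
  unfold surplus
  rcases le_total (M.mean a x u - M.predMean ℓ t h x a) 0 with h | h
  · simp [max_eq_right h]
  · rw [max_eq_left h, sq]

theorem sum_belief_real (t : ℕ) (h : History A X t) :
    ∑ u, (M.belief ℓ t h u : ℝ) = 1 := by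
  exact_mod_cast M.sum_belief ℓ t h

theorem surplus_le {b : ℝ} (hb : ∀ (x : X) (a a' : A) (s s' : S), M.mean a x s - M.mean a' x s' ≤ b)
    (t : ℕ) (u : S) (h : History A X t) (x : X) (a : A) : M.surplus ℓ t u h x a ≤ b := by
  refine max_le ?_ (by simpa using hb x a a u u)
  have : M.mean a x u - M.predMean ℓ t h x a =
      ∑ v, (M.belief ℓ t h v : ℝ) * (M.mean a x u - M.mean a x v) := by
    simp_rw [mul_sub, Finset.sum_sub_distrib, ← Finset.sum_mul, sum_belief_real, one_mul, predMean]
  rw [this]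
  calc _ ≤ ∑ v, (M.belief ℓ t h v : ℝ) * b :=
        Finset.sum_le_sum fun v _ => mul_le_mul_of_nonneg_left (hb x a a u v) (NNReal.coe_nonneg _)
    _ = b := by rw [← Finset.sum_mul, sum_belief_real, one_mul]

theorem measurable_predMean (t : ℕ) :
    Measurable fun p : History A X t × (X × A) => M.predMean ℓ t p.1 p.2.1 p.2.2 :=
  Finset.measurable_sum _ fun u _ =>
    ((M.measurable_belief ℓ t u).coe_nnreal_real.comp measurable_fst).mul
      ((M.measurable_mean u).comp measurable_snd)

theorem measurable_surplus (t : ℕ) (u : S) :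
    Measurable fun p : History A X t × (X × A) => M.surplus ℓ t u p.1 p.2.1 p.2.2 :=
  (((M.measurable_mean u).comp measurable_snd).sub (M.measurable_predMean ℓ t)).max
    measurable_const

/-- The factor of a round in the exponential supermartingale. -/
noncomputable def tilt (V : ℝ) (t : ℕ) (u : S) (h : History A X t) (z : X × A × ℝ) : ℝ≥0∞ :=
  ENNReal.ofReal (Real.exp (M.surplus ℓ t u h z.1 z.2.1 / V *
    (z.2.2 - M.predMean ℓ t h z.1 z.2.1) - M.surplus ℓ t u h z.1 z.2.1 ^ 2 / (2 * V)))

/-- The weighted upward deviation of a reward from its mean. -/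
noncomputable def upNoise (V : ℝ) (t : ℕ) (u : S) (h : History A X t) (z : X × A × ℝ) : ℝ≥0∞ :=
  ENNReal.ofReal (M.surplus ℓ t u h z.1 z.2.1 / V * (z.2.2 - M.mean z.2.1 z.1 u))

/-- The weighted downward deviation of a reward from its mean. -/
noncomputable def downNoise (V : ℝ) (t : ℕ) (u : S) (h : History A X t) (z : X × A × ℝ) : ℝ≥0∞ :=
  ENNReal.ofReal (M.surplus ℓ t u h z.1 z.2.1 / V * (M.mean z.2.1 z.1 u - z.2.2))

/-- A lower bound for the information gain of a round. -/
noncomputable def gain (V : ℝ) (t : ℕ) (u : S) (h : History A X t) (z : X × A × ℝ) : ℝ≥0∞ :=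
  ENNReal.ofReal (M.surplus ℓ t u h z.1 z.2.1 ^ 2 / (2 * V))

/-! ### Measurability of the per-round functionals -/

section Measurability

variable (V : ℝ) (t : ℕ) (u : S)

theorem measurable_surplus_outcome : Measurable fun p : History A X t × (X × A × ℝ) =>
    M.surplus ℓ t u p.1 p.2.1 p.2.2.1 :=
  (M.measurable_surplus ℓ t u).comp
    (by fun_prop : Measurable fun p : History A X t × (X × A × ℝ) => (p.1, (p.2.1, p.2.2.1)))

theorem measurable_predMean_outcome : Measurable fun p : History A X t × (X × A × ℝ) =>
    M.predMean ℓ t p.1 p.2.1 p.2.2.1 :=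
  (M.measurable_predMean ℓ t).comp
    (by fun_prop : Measurable fun p : History A X t × (X × A × ℝ) => (p.1, (p.2.1, p.2.2.1)))

theorem measurable_mean_outcome : Measurable fun p : History A X t × (X × A × ℝ) =>
    M.mean p.2.2.1 p.2.1 u :=
  (M.measurable_mean u).comp
    (by fun_prop : Measurable fun p : History A X t × (X × A × ℝ) => (p.2.1, p.2.2.1))

theorem measurable_tilt :
    Measurable fun p : History A X t × (X × A × ℝ) => M.tilt ℓ V t u p.1 p.2 := by
  have h1 := M.measurable_surplus_outcome ℓ t u
  have h2 := M.measurable_predMean_outcome ℓ t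
  unfold tilt
  fun_prop

theorem measurable_upNoise :
    Measurable fun p : History A X t × (X × A × ℝ) => M.upNoise ℓ V t u p.1 p.2 := by
  have h1 := M.measurable_surplus_outcome ℓ t u
  have h2 := M.measurable_mean_outcome t u
  unfold upNoise
  fun_prop

theorem measurable_downNoise :
    Measurable fun p : History A X t × (X × A × ℝ) => M.downNoise ℓ V t u p.1 p.2 := by
  have h1 := M.measurable_surplus_outcome ℓ t u
  have h2 := M.measurable_mean_outcome t u
  unfold downNoise
  fun_prop

theorem measurable_gain :
    Measurable fun p : History A X t × (X × A × ℝ) => M.gain ℓ V t u p.1 p.2 := by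
  have h1 := M.measurable_surplus_outcome ℓ t u
  unfold gain
  fun_prop

end Measurability

theorem measurable_upNoise_apply (V : ℝ) (t : ℕ) (u : S) (h : History A X t) :
    Measurable (M.upNoise ℓ V t u h) := by
  have hp : Measurable fun z : X × A × ℝ => (h, z) := measurable_prodMk_left
  have := (M.measurable_upNoise ℓ V t u).comp hp
  exact this

theorem measurable_downNoise_apply (V : ℝ) (t : ℕ) (u : S) (h : History A X t) :
    Measurable (M.downNoise ℓ V t u h) := by
  have hp : Measurable fun z : X × A × ℝ => (h, z) := measurable_prodMk_left
  have := (M.measurable_downNoise ℓ V t u).comp hp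
  exact this

theorem measurable_tilt_apply (V : ℝ) (t : ℕ) (u : S) (h : History A X t) :
    Measurable (M.tilt ℓ V t u h) := by
  have hp : Measurable fun z : X × A × ℝ => (h, z) := measurable_prodMk_left
  have := (M.measurable_tilt ℓ V t u).comp hp
  exact this

/-- Up to exponentiation, the tilt is the sum of the noise and the information gain. -/
theorem exists_cumSum_cumProd_eq {V : ℝ} (hV : 0 < V) (n : ℕ) (s : Fin n → S) (h : History A X n) :
    ∃ a b d : ℝ, 0 ≤ a ∧ 0 ≤ b ∧ 0 ≤ d ∧
      cumSum (M.upNoise ℓ V) n s h = ENNReal.ofReal a ∧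
      cumSum (M.downNoise ℓ V) n s h = ENNReal.ofReal b ∧
      cumSum (M.gain ℓ V) n s h = ENNReal.ofReal d ∧
      cumProd (M.tilt ℓ V) n s h = ENNReal.ofReal (Real.exp (a - b + d)) := by
  induction n with
  | zero => exact ⟨0, 0, 0, le_rfl, le_rfl, le_rfl, by simp [cumSum, cumProd]⟩
  | succ n ih =>
    obtain ⟨a, b, d, ha, hb, hd, e1, e2, e3, e4⟩ := ih (Fin.init s) (Fin.init h)
    set u := s (Fin.last n)
    set z := h (Fin.last n)
    set e := M.surplus ℓ n u (Fin.init h) z.1 z.2.1 with he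
    have hmul := M.surplus_mul ℓ n u (Fin.init h) z.1 z.2.1
    rw [← he] at hmul
    set y := e / V * (z.2.2 - M.mean z.2.1 z.1 u) with hy
    have hD : 0 ≤ e ^ 2 / (2 * V) := by positivity
    -- The noise `y` of the last round is split into its positive and negative parts.
    refine ⟨a + max y 0, b + max (-y) 0, d + e ^ 2 / (2 * V), by positivity, by positivity,
      by positivity, ?_, ?_, ?_, ?_⟩
    · rw [cumSum, e1, ENNReal.ofReal_add ha (le_max_right _ _), upNoise, ENNReal.ofReal_max]
      simp [hy, he, u, z]
    · rw [cumSum, e2, ENNReal.ofReal_add hb (le_max_right _ _), downNoise, ENNReal.ofReal_max]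
      have : -y = e / V * (M.mean z.2.1 z.1 u - z.2.2) := by rw [hy]; ring
      simp [this, he, u, z]
    · rw [cumSum, e3, ENNReal.ofReal_add hd hD, gain]
    · rw [cumProd, e4, tilt, ← ENNReal.ofReal_mul (Real.exp_pos _).le, ← Real.exp_add]
      congr 2
      have h1 : max y 0 - max (-y) 0 = y := by
        rcases le_total y 0 with h | h
        · rw [max_eq_right h, max_eq_left (by linarith)]; ring
        · rw [max_eq_left h, max_eq_right (by linarith)]; ring
      -- Splitting the reward around its true mean adds the drift `e ^ 2 / V`, from which the
      -- correction takes away half.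
      have h2 : e / V * (z.2.2 - M.predMean ℓ n (Fin.init h) z.1 z.2.1) - e ^ 2 / (2 * V) =
          y + e ^ 2 / (2 * V) := by
        rw [hy]
        field_simp
        linear_combination 2 * hmul
      change a - b + d + (e / V * (z.2.2 - M.predMean ℓ n (Fin.init h) z.1 z.2.1) -
        e ^ 2 / (2 * V)) = _
      rw [h2]
      linear_combination -h1

/-! ### Centering of the noise, the supermartingale property, and the bound on the gain -/

variable {σ b : ℝ}

/-- The weight `surplus / V` is fixed before the reward is drawn, so the noise stays centered. -/
theorem lintegral_upNoise_eq_downNoise (hM : M.SubGaussianRewards σ) {V : ℝ} (hV : 0 < V)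
    (π : Policy A X) (t : ℕ) :
    M.roundMean π t (M.upNoise ℓ V t) = M.roundMean π t (M.downNoise ℓ V t) := by
  refine Finset.sum_congr rfl fun u _ => lintegral_congr fun h => ?_
  rw [lintegral_step _ _ _ _ _ (M.measurable_upNoise_apply ℓ V t u h),
    lintegral_step _ _ _ _ _ (M.measurable_downNoise_apply ℓ V t u h)]
  refine lintegral_congr fun q => ?_
  have hc : 0 ≤ M.surplus ℓ t u h q.1 q.2 / V := div_nonneg (surplus_nonneg ..) hV.le
  simp only [upNoise, downNoise, ENNReal.ofReal_mul hc]
  rw [lintegral_const_mul' _ _ ENNReal.ofReal_ne_top, lintegral_const_mul' _ _ ENNReal.ofReal_ne_top,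
    hM.lintegral_neg_part_eq]

/-- Finiteness is what permits cancelling the noise from both sides of an inequality in `ℝ≥0∞`. -/
theorem roundMean_upNoise_ne_top (hM : M.SubGaussianRewards σ)
    (hb : ∀ (x : X) (a a' : A) (s s' : S), M.mean a x s - M.mean a' x s' ≤ b)
    {V : ℝ} (hV : 0 < V) (π : Policy A X) (t : ℕ) :
    M.roundMean π t (M.upNoise ℓ V t) ≠ ∞ := by
  set K : ℝ≥0∞ := ENNReal.ofReal (b / V) * ENNReal.ofReal (Real.exp (σ ^ 2 / 2))
  have h1 : ∀ u h, ∫⁻ z, M.upNoise ℓ V t u h z ∂M.step π t u h ≤ K := fun u h => by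
    rw [lintegral_step _ _ _ _ _ (M.measurable_upNoise_apply ℓ V t u h)]
    calc _ ≤ ∫⁻ q, K ∂M.play π t h := lintegral_mono fun q => by
          have hc : 0 ≤ M.surplus ℓ t u h q.1 q.2 / V := div_nonneg (surplus_nonneg ..) hV.le
          simp only [upNoise, ENNReal.ofReal_mul hc]
          rw [lintegral_const_mul' _ _ ENNReal.ofReal_ne_top]
          refine mul_le_mul' (ENNReal.ofReal_le_ofReal ?_) (hM.lintegral_pos_part_le ..)
          exact div_le_div_of_nonneg_right (M.surplus_le ℓ hb ..) hV.le
      _ = K := by rw [lintegral_const, measure_univ, mul_one]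
  have h2 : M.roundMean π t (M.upNoise ℓ V t) ≤ K := calc
    _ ≤ ∑ u, ∫⁻ _, K ∂M.joint π t u :=
      Finset.sum_le_sum fun u _ => lintegral_mono fun h => h1 u h
    _ = K := by
      rw [← lintegral_mixture_eq_sum_joint M π t fun _ => K, lintegral_const, measure_univ, mul_one]
  exact (h2.trans_lt (ENNReal.mul_lt_top ENNReal.ofReal_lt_top ENNReal.ofReal_lt_top)).ne

/-- Under the belief, the deviation of the reward from its prediction is a centered latent mean of
diameter at most `b` plus sub-Gaussian noise. Its exponential moment at `l` is at most `exp (l² b² +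
σ² l² / 2)`, which the correction `V l² / 2` absorbs. The slope `l` is nonnegative because `surplus`
is a positive part; the sub-Gaussian bound covers only such slopes. -/
theorem sum_belief_mul_lintegral_tilt_le (hM : M.SubGaussianRewards σ)
    (hb : ∀ (x : X) (a a' : A) (s s' : S), M.mean a x s - M.mean a' x s' ≤ b)
    {V : ℝ} (hV : 0 < V) (hV' : σ ^ 2 + 2 * b ^ 2 ≤ V) (π : Policy A X) (t : ℕ) (v : S)
    (h : History A X t) :
    ∑ u, (M.belief ℓ t h u : ℝ≥0∞) * ∫⁻ z, M.tilt ℓ V t v h z ∂M.step π t u h ≤ 1 := by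
  have hm := M.measurable_tilt_apply ℓ V t v h
  simp_rw [fun u => M.lintegral_step π t u h hm]
  rw [sum_mul_lintegral _ fun u => M.measurable_lintegral_reward u hm]
  have h0 : ∫⁻ _, 1 ∂M.play π t h = 1 := by rw [lintegral_one, measure_univ]
  rw [← h0]
  refine lintegral_mono fun q => ?_
  obtain ⟨x, a⟩ := q
  simp only [tilt]
  set e := M.surplus ℓ t v h x a
  set m := M.predMean ℓ t h x a with hmdef
  have hl : 0 ≤ e / V := div_nonneg (surplus_nonneg ..) hV.le
  set l := e / V with hldef
  have heV : e ^ 2 / (2 * V) = V * l ^ 2 / 2 := by rw [hldef]; field_simp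
  rw [heV]
  have h1 : ∀ u, (M.belief ℓ t h u : ℝ≥0∞) *
      ∫⁻ r, ENNReal.ofReal (Real.exp (l * (r - m) - V * l ^ 2 / 2)) ∂M.reward (a, x, u) ≤
      ENNReal.ofReal ((M.belief ℓ t h u : ℝ) * Real.exp (l * (M.mean a x u - m)) *
        Real.exp (σ ^ 2 * l ^ 2 / 2 - V * l ^ 2 / 2)) := fun u => by
    rw [mul_assoc, ENNReal.ofReal_mul (NNReal.coe_nonneg _), ENNReal.ofReal_coe_nnreal]
    gcongr
    have h2 : ∀ r, ENNReal.ofReal (Real.exp (l * (r - m) - V * l ^ 2 / 2)) =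
        ENNReal.ofReal (Real.exp (l * (M.mean a x u - m) - V * l ^ 2 / 2)) *
        ENNReal.ofReal (Real.exp (l * (r - M.mean a x u))) := fun r => by
      rw [← ENNReal.ofReal_mul (Real.exp_pos _).le, ← Real.exp_add]
      congr 2; ring
    rw [lintegral_congr h2, lintegral_const_mul' _ _ ENNReal.ofReal_ne_top]
    refine (mul_le_mul_right (hM.lintegral_exp_le a x u hl) _).trans (le_of_eq ?_)
    rw [← ENNReal.ofReal_mul (Real.exp_pos _).le, ← Real.exp_add, ← Real.exp_add]
    congr 2; ring
  refine (Finset.sum_le_sum fun u _ => h1 u).trans ?_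
  rw [← ENNReal.ofReal_sum_of_nonneg fun u _ => by positivity, ← Finset.sum_mul]
  refine ENNReal.ofReal_le_one.2 ?_
  have h3 := sum_mul_exp_le (M.belief ℓ t h) (M.sum_belief ℓ t h) (fun u => M.mean a x u)
    (fun u v => hb x a a u v) l
  refine (mul_le_mul_of_nonneg_right h3 (Real.exp_pos _).le).trans ?_
  rw [← Real.exp_add]
  refine Real.exp_le_one_iff.2 ?_
  nlinarith [sq_nonneg l]

/-- The information gain is at most the code length of the latent states, for every
subprobability `Q` on latent state sequences. -/
theorem sum_roundMean_gain_le (hM : M.SubGaussianRewards σ)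
    (hb : ∀ (x : X) (a a' : A) (s s' : S), M.mean a x s - M.mean a' x s' ≤ b)
    {V : ℝ} (hV : 0 < V) (hV' : σ ^ 2 + 2 * b ^ 2 ≤ V) (π : Policy A X) (n : ℕ)
    (Q : (Fin n → S) → ℝ≥0) (hQ : ∀ s, 0 < Q s) (hQ1 : ∑ s, Q s = 1) :
    ∑ t ∈ Finset.range n, M.roundMean π t (M.gain ℓ V t) ≤
      ∑ s, (M.pathProb n s : ℝ≥0∞) * ENNReal.ofReal (-Real.log (Q s)) := by
  have hup := measurable_cumSum (M.measurable_upNoise ℓ V) n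
  have hdown := measurable_cumSum (M.measurable_downNoise ℓ V) n
  have hgain := measurable_cumSum (M.measurable_gain ℓ V) n
  have htilt := measurable_cumProd (M.measurable_tilt ℓ V) n
  have hP : ∑ s, (M.pathProb n s : ℝ≥0∞) = 1 := by exact_mod_cast M.sum_pathProb n
  have hle1 : ∀ s, Q s ≤ 1 := fun s =>
    hQ1 ▸ Finset.single_le_sum (f := Q) (fun _ _ => zero_le) (Finset.mem_univ s)
  -- This is `1 + x ≤ exp x` at `x = log Q(s) + noise + gain`, rearranged so that every term is
  -- nonnegative.
  have hpt : ∀ s h, 1 + cumSum (M.upNoise ℓ V) n s h + cumSum (M.gain ℓ V) n s h ≤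
      Q s * cumProd (M.tilt ℓ V) n s h + cumSum (M.downNoise ℓ V) n s h +
        ENNReal.ofReal (-Real.log (Q s)) := fun s h => by
    obtain ⟨a, b, d, ha, hb, hd, e1, e2, e3, e4⟩ := M.exists_cumSum_cumProd_eq ℓ hV n s h
    have hlog : 0 ≤ -Real.log (Q s) := by
      have := Real.log_nonpos (NNReal.coe_nonneg (Q s)) (by exact_mod_cast hle1 s)
      linarith
    have hq : (Q s : ℝ≥0∞) = ENNReal.ofReal (Real.exp (Real.log (Q s))) := by
      rw [Real.exp_log (by exact_mod_cast hQ s), ENNReal.ofReal_coe_nnreal]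
    rw [e1, e2, e3, e4, hq, ← ENNReal.ofReal_mul (Real.exp_pos _).le, ← Real.exp_add,
      ← ENNReal.ofReal_one, ← ENNReal.ofReal_add zero_le_one ha,
      ← ENNReal.ofReal_add (by positivity) hd,
      ← ENNReal.ofReal_add (Real.exp_pos _).le hb, ← ENNReal.ofReal_add (by positivity) hlog]
    refine ENNReal.ofReal_le_ofReal ?_
    linarith [Real.add_one_le_exp (Real.log (Q s) + (a - b + d))]
  have hint : ∀ s, 1 + ∫⁻ h, cumSum (M.upNoise ℓ V) n s h ∂M.historyLaw π n s +
      ∫⁻ h, cumSum (M.gain ℓ V) n s h ∂M.historyLaw π n s ≤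
      Q s * ∫⁻ h, cumProd (M.tilt ℓ V) n s h ∂M.historyLaw π n s +
      ∫⁻ h, cumSum (M.downNoise ℓ V) n s h ∂M.historyLaw π n s +
        ENNReal.ofReal (-Real.log (Q s)) := fun s => by
    have := lintegral_mono (μ := M.historyLaw π n s) (hpt s)
    rw [lintegral_add_right _ (hgain s), lintegral_add_right _ (hup s),
      lintegral_add_right _ measurable_const, lintegral_add_right _ (hdown s),
      lintegral_const_mul _ (htilt s)] at this
    simpa only [lintegral_const, measure_univ, mul_one] using this
  have hsum := Finset.sum_le_sum fun s (_ : s ∈ Finset.univ) =>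
    mul_le_mul_right (hint s) (M.pathProb n s : ℝ≥0∞)
  simp only [mul_add, Finset.sum_add_distrib, mul_one, hP] at hsum
  rw [M.sum_pathProb_mul_lintegral_cumSum π (M.measurable_upNoise ℓ V),
    M.sum_pathProb_mul_lintegral_cumSum π (M.measurable_downNoise ℓ V),
    M.sum_pathProb_mul_lintegral_cumSum π (M.measurable_gain ℓ V),
    ← Finset.sum_congr rfl fun t _ => M.lintegral_upNoise_eq_downNoise ℓ hM hV π t] at hsum
  have hfin : ∑ t ∈ Finset.range n, M.roundMean π t (M.upNoise ℓ V t) ≠ ∞ :=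
    ENNReal.sum_ne_top.2 fun t _ => M.roundMean_upNoise_ne_top ℓ hM hb hV π t
  -- The law given `s`, weighted by `P(s)`, is one summand of the marginal law, so each path
  -- contributes at most `Q(s)`.
  have hexp : ∑ s, (M.pathProb n s : ℝ≥0∞) *
      (Q s * ∫⁻ h, cumProd (M.tilt ℓ V) n s h ∂M.historyLaw π n s) ≤ 1 := calc
    _ ≤ ∑ s, (Q s : ℝ≥0∞) * 1 := by
      refine Finset.sum_le_sum fun s _ => ?_
      rw [mul_left_comm]
      gcongr
      refine le_trans ?_ (M.lintegral_cumProd_mixture_le ℓ π (M.measurable_tilt ℓ V)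
        (fun t v h => M.sum_belief_mul_lintegral_tilt_le ℓ hM hb hV hV' π t v h) n s)
      rw [lintegral_mixture]
      exact Finset.single_le_sum (f := fun s' => (M.pathProb n s' : ℝ≥0∞) *
        ∫⁻ h, cumProd (M.tilt ℓ V) n s h ∂M.historyLaw π n s') (fun _ _ => zero_le)
        (Finset.mem_univ s)
    _ = 1 := by simp only [mul_one]; exact_mod_cast hQ1
  generalize ∑ t ∈ Finset.range n, M.roundMean π t (M.upNoise ℓ V t) = U at hsum hfin
  have h2 := hsum.trans (add_le_add_left (add_le_add_left hexp U) _)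
  exact (ENNReal.add_le_add_iff_left (ENNReal.add_ne_top.2 ⟨ENNReal.one_ne_top, hfin⟩)).1 h2

end LatentBandit

/-- Thompson sampling from `p` among the greedy actions: the regret is controlled by the squared
surplus of the mean rewards over their averages. -/
theorem sum_sum_gap_le {S : Type*} [Fintype S] (p : S → ℝ≥0) (hp : ∑ u, p u = 1) (m : S → S → ℝ)
    {α : ℝ} (hα : 0 < α) :
    ∑ u, ∑ v, (p u : ℝ) * p v * (m u u - m u v) ≤
      α / 2 * ∑ u, ∑ v, (p u : ℝ) * p v * max (m u v - ∑ w, (p w : ℝ) * m w v) 0 ^ 2 +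
        Fintype.card S / (2 * α) := by
  have hp' : ∑ u, (p u : ℝ) = 1 := by exact_mod_cast hp
  set c : S → ℝ := fun v => ∑ w, (p w : ℝ) * m w v with hc
  set e : S → S → ℝ := fun u v => max (m u v - c v) 0 with he
  -- The true and sampled states have the same law, so the sampled arm's mean averages to `∑ v, p v
  -- * c v`.
  have h1 : ∑ u, ∑ v, (p u : ℝ) * p v * (m u u - m u v) = ∑ u, (p u : ℝ) * (m u u - c u) := by
    have h2 : ∑ u, ∑ v, (p u : ℝ) * p v * m u u = ∑ u, (p u : ℝ) * m u u := by
      refine Finset.sum_congr rfl fun u _ => ?_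
      rw [← Finset.sum_mul, ← Finset.mul_sum, hp', mul_one]
    have h3 : ∑ u, ∑ v, (p u : ℝ) * p v * m u v = ∑ v, (p v : ℝ) * c v := by
      rw [Finset.sum_comm]
      refine Finset.sum_congr rfl fun v _ => ?_
      rw [hc, Finset.mul_sum]
      exact Finset.sum_congr rfl fun u _ => by ring
    simp_rw [mul_sub, Finset.sum_sub_distrib, h2, h3]
  have h2 : ∀ u, (p u : ℝ) * (m u u - c u) ≤ α / 2 * (p u * p u * e u u ^ 2) + 1 / (2 * α) := by
    intro u
    have h3 : (p u : ℝ) * (m u u - c u) ≤ p u * e u u :=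
      mul_le_mul_of_nonneg_left (le_max_left _ _) (p u).2
    have h4 : α / 2 * (p u * p u * e u u ^ 2) + 1 / (2 * α) - p u * e u u =
        (α * (p u * e u u) - 1) ^ 2 / (2 * α) := by
      field_simp
      ring
    have h5 : 0 ≤ (α * (p u * e u u) - 1) ^ 2 / (2 * α) := by positivity
    linarith
  rw [h1]
  calc ∑ u, (p u : ℝ) * (m u u - c u)
      ≤ ∑ u, (α / 2 * (p u * p u * e u u ^ 2) + 1 / (2 * α)) := Finset.sum_le_sum fun u _ => h2 u
    _ = α / 2 * ∑ u, (p u * p u * e u u ^ 2 : ℝ) + Fintype.card S / (2 * α) := by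
      rw [Finset.sum_add_distrib, ← Finset.mul_sum]
      simp [div_eq_mul_inv]
    _ ≤ _ := by
      -- The diagonal is the event that the sampled state is the true one; the off-diagonal terms
      -- are nonnegative.
      have : ∀ u, (p u * p u * e u u ^ 2 : ℝ) ≤ ∑ v, (p u : ℝ) * p v * e u v ^ 2 := fun u =>
        Finset.single_le_sum (f := fun v => (p u : ℝ) * p v * e u v ^ 2)
          (fun v _ => by positivity) (Finset.mem_univ u)
      have := Finset.sum_le_sum fun u (_ : u ∈ Finset.univ) => this u
      gcongr

/-! ### Transition probabilities and the coding chain -/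

namespace LatentBandit

variable {A X S : Type*} [MeasurableSpace A] [MeasurableSpace X]
  [Fintype S] [MeasurableSpace S]

theorem nonempty_state (M : LatentBandit A X S) : Nonempty S := by
  by_contra h
  have := not_nonempty_iff.1 h
  simpa using M.sum_prior

theorem trans_le_one (M : LatentBandit A X S) (v u : S) : M.trans v u ≤ 1 :=
  M.sum_trans v ▸ Finset.single_le_sum (f := M.trans v) (fun _ _ => zero_le) (Finset.mem_univ u)

theorem one_sub_trans_le_changeProb (M : LatentBandit A X S) (v : S) :
    1 - (M.trans v v : ℝ) ≤ M.changeProb :=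
  sub_le_sub_left (ciInf_le (Set.finite_range fun s => (M.trans s s : ℝ)).bddBelow v) _

theorem changeProb_nonneg (M : LatentBandit A X S) : 0 ≤ M.changeProb := by
  obtain ⟨v⟩ := M.nonempty_state
  have h1 : (M.trans v v : ℝ) ≤ 1 := by exact_mod_cast M.trans_le_one v v
  linarith [M.one_sub_trans_le_changeProb v]

/-! ### The code length of the latent states -/

open Classical in
/-- The same bandit with another law of the latent states: the first one is uniform, and in each
round it is redrawn uniformly with probability `1 / (k + 1)`. -/
noncomputable def lazyUniform (M : LatentBandit A X S) (k : ℕ) : LatentBandit A X S :=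
  { M with
    prior := fun _ => (Fintype.card S : ℝ≥0)⁻¹
    sum_prior := by
      have := M.nonempty_state
      simp
    trans := fun s s' => (if s = s' then (k : ℝ≥0) / (k + 1) else 0) +
      ((k + 1) * (Fintype.card S : ℝ≥0))⁻¹
    sum_trans := fun s => by
      have := M.nonempty_state
      have hc : (Fintype.card S : ℝ≥0) ≠ 0 := by simp
      rw [Finset.sum_add_distrib]
      simp only [Finset.sum_ite_eq, Finset.mem_univ, if_true, Finset.sum_const, Finset.card_univ,
        nsmul_eq_mul]
      field_simp }

theorem le_lazyUniform_trans (M : LatentBandit A X S) (k : ℕ) (v u : S) :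
    ((k + 1) * (Fintype.card S : ℝ))⁻¹ ≤ ((M.lazyUniform k).trans v u : ℝ) := by
  simp only [lazyUniform]
  push_cast
  refine le_add_of_nonneg_left ?_
  split_ifs <;> positivity

theorem le_lazyUniform_trans_self (M : LatentBandit A X S) (k : ℕ) (v : S) :
    (k : ℝ) / (k + 1) ≤ ((M.lazyUniform k).trans v v : ℝ) := by
  simp only [lazyUniform, if_true]
  push_cast
  exact le_add_of_nonneg_right (by positivity)

theorem lazyUniform_trans_pos (M : LatentBandit A X S) (k : ℕ) (v u : S) :
    0 < (M.lazyUniform k).trans v u := by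
  have := M.nonempty_state
  have h : 0 < ((k + 1) * (Fintype.card S : ℝ))⁻¹ := by
    have : 0 < (Fintype.card S : ℝ) := by exact_mod_cast Fintype.card_pos
    positivity
  exact_mod_cast h.trans_le (M.le_lazyUniform_trans k v u)

theorem pathProb_lazyUniform_pos (M : LatentBandit A X S) (k n : ℕ) (s : Fin n → S) :
    0 < (M.lazyUniform k).pathProb n s := by
  have := M.nonempty_state
  cases n with
  | zero => simp [pathProb]
  | succ n =>
    refine mul_pos ?_ (Finset.prod_pos fun i _ => M.lazyUniform_trans_pos k _ _)
    simp [lazyUniform, Fintype.card_pos]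

/-- Staying costs at most `log ((k + 1) / k) ≤ 1 / k`. A switch costs at most `log ((k + 1) |S|)`
and has probability at most `p`. -/
theorem sum_trans_mul_log_le (M : LatentBandit A X S) {k : ℕ} (hk : 1 ≤ k) (v : S) :
    ∑ u, (M.trans v u : ℝ) * (-Real.log ((M.lazyUniform k).trans v u)) ≤
      1 / k + M.changeProb * Real.log ((k + 1) * Fintype.card S) := by
  classical
  have := M.nonempty_state
  have hcard : (1 : ℝ) ≤ Fintype.card S := by exact_mod_cast Fintype.card_pos (α := S)
  have hk' : (1 : ℝ) ≤ k := by exact_mod_cast hk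
  have hL : 0 ≤ Real.log ((k + 1) * (Fintype.card S : ℝ)) := Real.log_nonneg (by nlinarith)
  have h1 : ∀ u, -Real.log ((M.lazyUniform k).trans v u) ≤
      Real.log ((k + 1) * Fintype.card S) := fun u => by
    rw [neg_le, ← Real.log_inv]
    exact Real.log_le_log (by positivity) (M.le_lazyUniform_trans k v u)
  have h2 : -Real.log ((M.lazyUniform k).trans v v) ≤ 1 / k := by
    have h3 := Real.log_le_log (by positivity) (M.le_lazyUniform_trans_self k v)
    have h4 := Real.log_le_sub_one_of_pos (x := ((k : ℝ) + 1) / k) (by positivity)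
    rw [← inv_div, Real.log_inv] at h3
    have h5 : ((k : ℝ) + 1) / k - 1 = 1 / k := by field_simp; ring
    linarith
  have h3 : ∑ u ∈ Finset.univ.erase v, (M.trans v u : ℝ) = 1 - M.trans v v := by
    rw [eq_sub_iff_add_eq, Finset.sum_erase_add _ _ (Finset.mem_univ v)]
    exact_mod_cast M.sum_trans v
  rw [← Finset.add_sum_erase _ _ (Finset.mem_univ v)]
  refine add_le_add ?_ ?_
  · have h4 : (M.trans v v : ℝ) ≤ 1 := by exact_mod_cast M.trans_le_one v v
    calc _ ≤ (M.trans v v : ℝ) * (1 / k) := mul_le_mul_of_nonneg_left h2 (NNReal.coe_nonneg _)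
      _ ≤ 1 * (1 / k) := mul_le_mul_of_nonneg_right h4 (by positivity)
      _ = _ := one_mul _
  · calc _ ≤ ∑ u ∈ Finset.univ.erase v, (M.trans v u : ℝ) *
          Real.log ((k + 1) * Fintype.card S) :=
        Finset.sum_le_sum fun u _ => mul_le_mul_of_nonneg_left (h1 u) (NNReal.coe_nonneg _)
      _ = (1 - M.trans v v) * Real.log ((k + 1) * Fintype.card S) := by rw [← Finset.sum_mul, h3]
      _ ≤ _ := mul_le_mul_of_nonneg_right (M.one_sub_trans_le_changeProb v) hL

/-- Chain rule for the cross entropy: the uniform first state costs `log |S|`, and each of the `n`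
transitions adds its expected conditional code length. -/
theorem sum_pathProb_mul_log_le (M : LatentBandit A X S) {k : ℕ} (hk : 1 ≤ k) (n : ℕ) :
    ∑ s, (M.pathProb (n + 1) s : ℝ) * (-Real.log ((M.lazyUniform k).pathProb (n + 1) s)) ≤
      Real.log (Fintype.card S) +
        n * (1 / k + M.changeProb * Real.log ((k + 1) * Fintype.card S)) := by
  induction n with
  | zero =>
    rw [sum_eq_sum_sum_snoc]
    simp_rw [pathProb_snoc_zero]
    have hp : ∑ u, (M.prior u : ℝ) = 1 := by exact_mod_cast M.sum_prior
    simp [lazyUniform, ← Finset.sum_mul, hp]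
  | succ n ih =>
    rw [sum_eq_sum_sum_snoc]
    have h1 : ∀ (s : Fin (n + 1) → S) u,
        (M.pathProb (n + 1 + 1) (Fin.snoc (α := fun _ => S) s u) : ℝ) *
        (-Real.log ((M.lazyUniform k).pathProb (n + 1 + 1) (Fin.snoc (α := fun _ => S) s u))) =
        (M.trans (s (Fin.last n)) u : ℝ) * ((M.pathProb (n + 1) s : ℝ) *
          (-Real.log ((M.lazyUniform k).pathProb (n + 1) s))) +
        (M.pathProb (n + 1) s : ℝ) * ((M.trans (s (Fin.last n)) u : ℝ) *
          (-Real.log ((M.lazyUniform k).trans (s (Fin.last n)) u))) := fun s u => by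
      rw [pathProb_snoc, pathProb_snoc, NNReal.coe_mul, NNReal.coe_mul, Real.log_mul]
      · ring
      · exact_mod_cast (M.pathProb_lazyUniform_pos k (n + 1) s).ne'
      · exact_mod_cast (M.lazyUniform_trans_pos k _ u).ne'
    have ht : ∀ v, ∑ u, (M.trans v u : ℝ) = 1 := fun v => by exact_mod_cast M.sum_trans v
    have hP : ∑ s, (M.pathProb (n + 1) s : ℝ) = 1 := by exact_mod_cast M.sum_pathProb (n + 1)
    simp_rw [h1, Finset.sum_add_distrib, ← Finset.sum_mul, ht, one_mul, ← Finset.mul_sum]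
    have h2 : ∑ s, (M.pathProb (n + 1) s : ℝ) * ∑ u, ((M.trans (s (Fin.last n)) u : ℝ) *
          (-Real.log ((M.lazyUniform k).trans (s (Fin.last n)) u))) ≤
        1 / k + M.changeProb * Real.log ((k + 1) * Fintype.card S) := by
      refine (Finset.sum_le_sum fun s _ => mul_le_mul_of_nonneg_left
        (M.sum_trans_mul_log_le hk (s (Fin.last n))) (NNReal.coe_nonneg _)).trans (le_of_eq ?_)
      rw [← Finset.sum_mul, hP, one_mul]
    push_cast
    linarith

/-- The code length of `n` rounds of latent states is of order `(1 + p n) log n` if there are at most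
`n` latent states. -/
theorem code_length_le (M : LatentBandit A X S) {n : ℕ} (hn : 2 ≤ n) (hS : Fintype.card S ≤ n) :
    ∑ s, (M.pathProb n s : ℝ≥0∞) *
      ENNReal.ofReal (-Real.log ((M.lazyUniform (n - 1)).pathProb n s)) ≤
      ENNReal.ofReal (3 * ((1 + M.changeProb * n) * Real.log n)) := by
  have := M.nonempty_state
  -- The redraw probability is `1 / (k + 1) = 1 / n`, so the `k = n - 1` stay costs `1 / k` add up
  -- to 1.
  obtain ⟨k, rfl⟩ : ∃ k, n = k + 1 := ⟨n - 1, by omega⟩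
  have hk : 1 ≤ k := by omega
  have hle1 : ∀ s, ((M.lazyUniform k).pathProb (k + 1) s : ℝ) ≤ 1 := fun s => by
    have := Finset.single_le_sum (f := (M.lazyUniform k).pathProb (k + 1)) (fun _ _ => zero_le)
      (Finset.mem_univ s)
    rw [sum_pathProb] at this
    exact_mod_cast this
  have hlog : ∀ s, 0 ≤ -Real.log ((M.lazyUniform k).pathProb (k + 1) s) := fun s =>
    neg_nonneg.2 (Real.log_nonpos (NNReal.coe_nonneg _) (hle1 s))
  simp only [Nat.add_sub_cancel]
  have e : ∀ s, (M.pathProb (k + 1) s : ℝ≥0∞) *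
      ENNReal.ofReal (-Real.log ((M.lazyUniform k).pathProb (k + 1) s)) =
      ENNReal.ofReal ((M.pathProb (k + 1) s : ℝ) *
        (-Real.log ((M.lazyUniform k).pathProb (k + 1) s))) := fun s => by
    rw [ENNReal.ofReal_mul (NNReal.coe_nonneg _), ENNReal.ofReal_coe_nnreal]
  simp_rw [e]
  rw [← ENNReal.ofReal_sum_of_nonneg fun s _ => mul_nonneg (NNReal.coe_nonneg _) (hlog s)]
  refine ENNReal.ofReal_le_ofReal ((M.sum_pathProb_mul_log_le hk k).trans ?_)
  have hcard : (1 : ℝ) ≤ Fintype.card S := by exact_mod_cast Fintype.card_pos (α := S)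
  have hS' : (Fintype.card S : ℝ) ≤ k + 1 := by exact_mod_cast hS
  have hk' : (1 : ℝ) ≤ k := by exact_mod_cast hk
  have hp := M.changeProb_nonneg
  push_cast
  have h1 : Real.log (Fintype.card S) ≤ Real.log (k + 1) := Real.log_le_log (by linarith) hS'
  have h2 : Real.log ((k + 1) * Fintype.card S) ≤ 2 * Real.log (k + 1) := by
    rw [Real.log_mul (by positivity) (by positivity)]
    linarith
  have h3 : 1 / 2 ≤ Real.log ((k : ℝ) + 1) :=
    le_trans (by linarith [Real.log_two_gt_d9]) (Real.log_le_log two_pos (by linarith))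
  have h4 : (k : ℝ) * (1 / k) = 1 := by field_simp
  have h5 : (k : ℝ) * (M.changeProb * Real.log ((k + 1) * Fintype.card S)) ≤
      (k + 1) * (M.changeProb * (2 * Real.log (k + 1))) := by
    gcongr
    · exact mul_nonneg hp (Real.log_nonneg (by nlinarith))
    · linarith
  have h6 : 0 ≤ ((k : ℝ) + 1) * (M.changeProb * Real.log (k + 1)) := by positivity
  -- The constant 3: the first state costs at most `log n`, the stays cost `1 ≤ 2 log n`, and the
  -- switches cost at most `2 p n log n`.
  rw [mul_add, h4]
  nlinarith

end LatentBandit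

namespace LatentBandit

variable {A X S : Type*} [MeasurableSpace A] [MeasurableSpace X]
  [Fintype S] [MeasurableSpace S]

/-! ### The regret of a round -/

theorem lintegral_mTS_kernel (M : LatentBandit A X S) (ℓ : M.Likelihood) (g : M.GreedyRule) (t : ℕ)
    (h : History A X t) (x : X) {F : A → ℝ≥0∞} (hF : Measurable F) :
    ∫⁻ a, F a ∂(M.mTS ℓ g).kernel t (h, x) = ∑ v, (M.belief ℓ t h v : ℝ≥0∞) * F (g.act x v) := by
  change ∫⁻ a, F a ∂(∑ v, (M.belief ℓ t h v : ℝ≥0∞) • Measure.dirac (g.act x v)) = _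
  simp only [lintegral_finsetSum_measure, lintegral_smul_measure, lintegral_dirac' _ hF, smul_eq_mul]

/-- Given history and context, the latent state and the sampled state of Thompson sampling are
independent with the same distribution. -/
theorem roundMean_mTS (M : LatentBandit A X S) (ℓ : M.Likelihood) (g : M.GreedyRule) (t : ℕ)
    {F : S → History A X t → X → A → ℝ≥0∞}
    (hF : ∀ u, Measurable fun p : History A X t × (X × A) => F u p.1 p.2.1 p.2.2) :
    M.roundMean (M.mTS ℓ g) t (fun u h z => F u h z.1 z.2.1) =
      ∫⁻ h, ∫⁻ x, ∑ u, (M.belief ℓ t h u : ℝ≥0∞) * ∑ v, (M.belief ℓ t h v : ℝ≥0∞) *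
        F u h x (g.act x v) ∂M.context t h ∂M.mixture (M.mTS ℓ g) t := by
  have hstep : ∀ u, Measurable fun h => ∫⁻ z, F u h z.1 z.2.1 ∂M.step (M.mTS ℓ g) t u h := fun u =>
    M.measurable_lintegral_step (M.mTS ℓ g) t u ((hF u).comp
      (by fun_prop : Measurable fun p : History A X t × (X × A × ℝ) => (p.1, (p.2.1, p.2.2.1))))
  have hb : ∀ u, Measurable fun h => (M.belief ℓ t h u : ℝ≥0∞) := fun u =>
    (M.measurable_belief ℓ t u).coe_nnreal_ennreal
  unfold roundMean
  simp_rw [fun u => M.lintegral_joint_eq ℓ (M.mTS ℓ g) t u (hstep u)]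
  rw [← lintegral_finsetSum]
  swap
  · exact fun u _ => (hb u).mul (hstep u)
  refine lintegral_congr fun h => ?_
  have hFh : ∀ u, Measurable fun q : X × A => F u h q.1 q.2 := fun u =>
    (hF u).comp measurable_prodMk_left
  have hFx : ∀ u x, Measurable fun a => F u h x a := fun u x =>
    (hFh u).comp measurable_prodMk_left
  have e : ∀ u, ∫⁻ z, F u h z.1 z.2.1 ∂M.step (M.mTS ℓ g) t u h =
      ∫⁻ x, ∑ v, (M.belief ℓ t h v : ℝ≥0∞) * F u h x (g.act x v) ∂M.context t h := fun u => by
    have hFz : Measurable fun z : X × A × ℝ => F u h z.1 z.2.1 :=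
      (hFh u).comp (by fun_prop : Measurable fun z : X × A × ℝ => (z.1, z.2.1))
    rw [lintegral_step _ _ _ _ _ hFz]
    simp only [lintegral_const, measure_univ, mul_one]
    rw [play, Kernel.lintegral_compProd _ _ _ (hFh u)]
    exact lintegral_congr fun x => M.lintegral_mTS_kernel ℓ g t h x (hFx u x)
  simp_rw [e]
  refine sum_mul_lintegral _ fun u => Finset.measurable_sum _ fun v _ => ?_
  exact ((hFh u).comp (measurable_id.prodMk (g.measurable_act v))).const_mul _

theorem iSup_mean_eq (M : LatentBandit A X S) (g : M.GreedyRule) (x : X) (u : S) :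
    ⨆ a, M.mean a x u = M.mean (g.act x u) x u := by
  have : Nonempty A := ⟨g.act x u⟩
  exact le_antisymm (ciSup_le fun a => g.mean_le x u a)
    (le_ciSup (f := fun a => M.mean a x u) ⟨_, by rintro _ ⟨a, rfl⟩; exact g.mean_le x u a⟩ _)

/-- The regret of action `a` in context `x` and latent state `u`. -/
noncomputable def gap (M : LatentBandit A X S) (u : S) (x : X) (a : A) : ℝ :=
  (⨆ a', M.mean a' x u) - M.mean a x u

theorem gap_eq (M : LatentBandit A X S) (g : M.GreedyRule) (u : S) (x : X) (a : A) :
    M.gap u x a = M.mean (g.act x u) x u - M.mean a x u := by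
  rw [gap, M.iSup_mean_eq g]

theorem gap_nonneg (M : LatentBandit A X S) (g : M.GreedyRule) (u : S) (x : X) (a : A) :
    0 ≤ M.gap u x a := by
  rw [M.gap_eq g]
  exact sub_nonneg.2 (g.mean_le x u a)

theorem measurable_gap (M : LatentBandit A X S) (g : M.GreedyRule) (u : S) :
    Measurable fun q : X × A => M.gap u q.1 q.2 := by
  simp_rw [M.gap_eq g]
  exact ((M.measurable_mean u).comp (measurable_fst.prodMk
    ((g.measurable_act u).comp measurable_fst))).sub (M.measurable_mean u)

/-- This integrates `sum_sum_gap_le` over history and context; the factor `α V` is `α / 2` divided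
by the `1 / (2V)` in `gain`. -/
theorem roundMean_gap_le (M : LatentBandit A X S) (ℓ : M.Likelihood) (g : M.GreedyRule) (t : ℕ)
    {V α : ℝ} (hV : 0 < V) (hα : 0 < α) :
    M.roundMean (M.mTS ℓ g) t (fun u _ z => ENNReal.ofReal (M.gap u z.1 z.2.1)) ≤
      ENNReal.ofReal (α * V) * M.roundMean (M.mTS ℓ g) t (M.gain ℓ V t) +
        ENNReal.ofReal (Fintype.card S / (2 * α)) := by
  have hαV : 0 ≤ α * V := by positivity
  have hpt : ∀ (h : History A X t) (x : X),
      ∑ u, (M.belief ℓ t h u : ℝ≥0∞) * ∑ v, (M.belief ℓ t h v : ℝ≥0∞) *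
        ENNReal.ofReal (M.gap u x (g.act x v)) ≤
      ENNReal.ofReal (α * V) * ∑ u, (M.belief ℓ t h u : ℝ≥0∞) * ∑ v, (M.belief ℓ t h v : ℝ≥0∞) *
        ENNReal.ofReal (M.surplus ℓ t u h x (g.act x v) ^ 2 / (2 * V)) +
        ENNReal.ofReal (Fintype.card S / (2 * α)) := fun h x => by
    have e : ∀ F : S → S → ℝ, (∀ u v, 0 ≤ F u v) →
        ∑ u, (M.belief ℓ t h u : ℝ≥0∞) * ∑ v, (M.belief ℓ t h v : ℝ≥0∞) * ENNReal.ofReal (F u v) =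
        ENNReal.ofReal (∑ u, ∑ v, (M.belief ℓ t h u : ℝ) * M.belief ℓ t h v * F u v) := by
      intro F hF
      rw [ENNReal.ofReal_sum_of_nonneg fun u _ => Finset.sum_nonneg fun v _ =>
        mul_nonneg (by positivity) (hF u v)]
      refine Finset.sum_congr rfl fun u _ => ?_
      rw [ENNReal.ofReal_sum_of_nonneg fun v _ => mul_nonneg (by positivity) (hF u v),
        Finset.mul_sum]
      refine Finset.sum_congr rfl fun v _ => ?_
      rw [ENNReal.ofReal_mul (by positivity), ENNReal.ofReal_mul (by positivity),
        ENNReal.ofReal_coe_nnreal, ENNReal.ofReal_coe_nnreal, mul_assoc]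
    rw [e _ fun u v => M.gap_nonneg g u x _, e _ fun u v => by positivity,
      ← ENNReal.ofReal_mul hαV, ← ENNReal.ofReal_add ?_ (by positivity)]
    · refine ENNReal.ofReal_le_ofReal ?_
      simp_rw [M.gap_eq g]
      refine (sum_sum_gap_le (M.belief ℓ t h) (M.sum_belief ℓ t h)
        (fun u v => M.mean (g.act x v) x u) hα).trans (le_of_eq ?_)
      congr 1
      simp_rw [Finset.mul_sum]
      refine Finset.sum_congr rfl fun u _ => Finset.sum_congr rfl fun v _ => ?_
      simp only [surplus, predMean]
      field_simp
    · exact mul_nonneg hαV (Finset.sum_nonneg fun u _ => Finset.sum_nonneg fun v _ => by positivity)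
  rw [M.roundMean_mTS ℓ g t (F := fun u _ x a => ENNReal.ofReal (M.gap u x a))
    fun u => ((M.measurable_gap g u).comp measurable_snd).ennreal_ofReal]
  have hgain := M.roundMean_mTS ℓ g t
    (F := fun u h x a => ENNReal.ofReal (M.surplus ℓ t u h x a ^ 2 / (2 * V)))
    fun u => (((M.measurable_surplus ℓ t u).pow_const 2).div_const _).ennreal_ofReal
  rw [show M.gain ℓ V t = fun u h z =>
    ENNReal.ofReal (M.surplus ℓ t u h z.1 z.2.1 ^ 2 / (2 * V)) from rfl, hgain]
  rw [← lintegral_const_mul' _ _ ENNReal.ofReal_ne_top]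
  simp_rw [← lintegral_const_mul' _ _ (ENNReal.ofReal_ne_top (r := α * V))]
  calc _ ≤ ∫⁻ h, ∫⁻ x, (ENNReal.ofReal (α * V) * ∑ u, (M.belief ℓ t h u : ℝ≥0∞) *
          ∑ v, (M.belief ℓ t h v : ℝ≥0∞) *
          ENNReal.ofReal (M.surplus ℓ t u h x (g.act x v) ^ 2 / (2 * V)) +
          ENNReal.ofReal (Fintype.card S / (2 * α))) ∂M.context t h ∂M.mixture (M.mTS ℓ g) t :=
        lintegral_mono fun h => lintegral_mono fun x => hpt h x
    _ = _ := by
      rw [← mul_one (ENNReal.ofReal (Fintype.card S / (2 * α))),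
        ← measure_univ (μ := M.mixture (M.mTS ℓ g) t), ← lintegral_const,
        ← lintegral_add_right _ measurable_const]
      refine lintegral_congr fun h => ?_
      rw [lintegral_add_right _ measurable_const, lintegral_const, measure_univ, lintegral_const,
        measure_univ, mul_one, mul_one]

/-! ### The Bayes regret -/

/-- Only this direction is needed, so integrability of the regret never has to be shown. -/
theorem ofReal_integral_le_lintegral {Ω : Type*} [MeasurableSpace Ω] {μ : Measure Ω} {f : Ω → ℝ}
    (hf : Measurable f) (h0 : ∀ ω, 0 ≤ f ω) :
    ENNReal.ofReal (∫ ω, f ω ∂μ) ≤ ∫⁻ ω, ENNReal.ofReal (f ω) ∂μ := by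
  rw [integral_eq_lintegral_of_nonneg_ae (ae_of_all _ h0) hf.aestronglyMeasurable]
  exact ENNReal.ofReal_toReal_le

theorem measurable_regret_summand (M : LatentBandit A X S) (g : M.GreedyRule) (n : ℕ)
    (s : Fin n → S) :
    Measurable fun h : History A X n => ∑ t, M.gap (s t) (h t).1 (h t).2.1 :=
  Finset.measurable_sum _ fun t _ => (M.measurable_gap g (s t)).comp
    (by fun_prop : Measurable fun h : History A X n => ((h t).1, (h t).2.1))

theorem ofReal_bayesRegret_le (M : LatentBandit A X S) (g : M.GreedyRule) (π : Policy A X) (n : ℕ) :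
    ENNReal.ofReal (M.bayesRegret π n) ≤ ∑ t ∈ Finset.range n,
      M.roundMean π t (fun u _ z => ENNReal.ofReal (M.gap u z.1 z.2.1)) := by
  have hsum : ∀ n (s : Fin n → S) (h : History A X n),
      ENNReal.ofReal (∑ t, M.gap (s t) (h t).1 (h t).2.1) =
      cumSum (fun _ u _ z => ENNReal.ofReal (M.gap u z.1 z.2.1)) n s h := by
    intro n s h
    induction n with
    | zero => simp [cumSum]
    | succ n ih =>
      rw [Fin.sum_univ_castSucc, ENNReal.ofReal_add
        (Finset.sum_nonneg fun t _ => M.gap_nonneg g _ _ _) (M.gap_nonneg g _ _ _), cumSum, ← ih]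
      rfl
  rw [← M.sum_pathProb_mul_lintegral_cumSum π
    (f := fun _ u _ z => ENNReal.ofReal (M.gap u z.1 z.2.1)) fun t u =>
      ((M.measurable_gap g u).comp
        (by fun_prop : Measurable fun p : History A X t × (X × A × ℝ) =>
          (p.2.1, p.2.2.1))).ennreal_ofReal]
  have hreg : ∀ s, M.regret π n s =
      ∫ h, ∑ t, M.gap (s t) (h t).1 (h t).2.1 ∂M.historyLaw π n s := fun s => rfl
  have hnn : ∀ (s : Fin n → S) (h : History A X n), 0 ≤ ∑ t, M.gap (s t) (h t).1 (h t).2.1 := fun s h =>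
    Finset.sum_nonneg fun t _ => M.gap_nonneg g _ _ _
  rw [bayesRegret, ENNReal.ofReal_sum_of_nonneg fun s _ =>
    mul_nonneg (NNReal.coe_nonneg _) ((hreg s).symm ▸ integral_nonneg (hnn s))]
  refine Finset.sum_le_sum fun s _ => ?_
  rw [ENNReal.ofReal_mul (NNReal.coe_nonneg _), ENNReal.ofReal_coe_nnreal, hreg]
  simp_rw [← hsum]
  gcongr
  exact ofReal_integral_le_lintegral (M.measurable_regret_summand g n s) (hnn s)

/-- Every gap is at most `b`. This covers the case of more latent states than rounds, where coding
the first state alone may cost more than `log n`. -/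
theorem bayesRegret_le_mul (M : LatentBandit A X S) (g : M.GreedyRule) {b : ℝ}
    (hb : ∀ (x : X) (a a' : A) (s s' : S), M.mean a x s - M.mean a' x s' ≤ b)
    (π : Policy A X) (n : ℕ) : M.bayesRegret π n ≤ n * b := by
  have hP : ∑ s, (M.pathProb n s : ℝ) = 1 := by exact_mod_cast M.sum_pathProb n
  have h1 : ∀ (s : Fin n → S) (h : History A X n), ∑ t, M.gap (s t) (h t).1 (h t).2.1 ≤ n * b := fun s h => by
    refine (Finset.sum_le_sum fun t _ => ?_ : _ ≤ ∑ _ : Fin n, b).trans (by simp)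
    rw [M.gap_eq g]
    exact hb _ _ _ _ _
  have h0 : ∀ (s : Fin n → S) (h : History A X n), 0 ≤ ∑ t, M.gap (s t) (h t).1 (h t).2.1 := fun s h =>
    Finset.sum_nonneg fun t _ => M.gap_nonneg g _ _ _
  have h2 : ∀ s, M.regret π n s ≤ n * b := fun s => by
    have := integral_mono_of_nonneg (μ := M.historyLaw π n s) (ae_of_all _ (h0 s))
      (integrable_const ((n : ℝ) * b)) (ae_of_all _ (h1 s))
    rwa [integral_const, probReal_univ, one_smul] at this
  refine (Finset.sum_le_sum fun s _ =>
    mul_le_mul_of_nonneg_left (h2 s) (NNReal.coe_nonneg _)).trans (le_of_eq ?_)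
  rw [← Finset.sum_mul, hP, one_mul]

/-- The regret bound before optimizing the weight `α` of the information gain. -/
theorem bayesRegret_mTS_le (M : LatentBandit A X S) (ℓ : M.Likelihood) (g : M.GreedyRule)
    {σ b : ℝ} (hM : M.SubGaussianRewards σ)
    (hb : ∀ (x : X) (a a' : A) (s s' : S), M.mean a x s - M.mean a' x s' ≤ b)
    {V α : ℝ} (hV : 0 < V) (hV' : σ ^ 2 + 2 * b ^ 2 ≤ V) (hα : 0 < α) {n : ℕ} (hn : 2 ≤ n)
    (hS : Fintype.card S ≤ n) :
    M.bayesRegret (M.mTS ℓ g) n ≤ α * V * (3 * ((1 + M.changeProb * n) * Real.log n)) +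
      n * (Fintype.card S / (2 * α)) := by
  have hp := M.changeProb_nonneg
  have hlog : 0 ≤ Real.log n := Real.log_natCast_nonneg n
  have hgain := (M.sum_roundMean_gain_le ℓ hM hb hV hV' (M.mTS ℓ g) n _
    (M.pathProb_lazyUniform_pos (n - 1) n) (sum_pathProb _ n)).trans (M.code_length_le hn hS)
  refine (ENNReal.ofReal_le_ofReal_iff (by positivity)).1 ?_
  calc ENNReal.ofReal (M.bayesRegret (M.mTS ℓ g) n)
      ≤ ∑ t ∈ Finset.range n, (ENNReal.ofReal (α * V) * M.roundMean (M.mTS ℓ g) t (M.gain ℓ V t) +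
        ENNReal.ofReal (Fintype.card S / (2 * α))) :=
        (M.ofReal_bayesRegret_le g _ n).trans
          (Finset.sum_le_sum fun t _ => M.roundMean_gap_le ℓ g t hV hα)
    _ ≤ ENNReal.ofReal (α * V) *
          ENNReal.ofReal (3 * ((1 + M.changeProb * n) * Real.log n)) +
        n * ENNReal.ofReal (Fintype.card S / (2 * α)) := by
      rw [Finset.sum_add_distrib, ← Finset.mul_sum, Finset.sum_const, Finset.card_range,
        nsmul_eq_mul]
      gcongr
    _ = _ := by
      rw [ENNReal.ofReal_add (by positivity) (by positivity), ENNReal.ofReal_mul (p := α * V)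
        (by positivity), ENNReal.ofReal_mul (p := (n : ℝ)) (by positivity), ENNReal.ofReal_natCast]

/-- The Bayes regret is of order `√(n |S| (1 + p n) log n)`. -/
theorem bayesRegret_mTS_le_sqrt (M : LatentBandit A X S) (ℓ : M.Likelihood) (g : M.GreedyRule)
    {σ b : ℝ} (hM : M.SubGaussianRewards σ)
    (hb : ∀ (x : X) (a a' : A) (s s' : S), M.mean a x s - M.mean a' x s' ≤ b)
    {n : ℕ} (hn : 2 ≤ n) :
    M.bayesRegret (M.mTS ℓ g) n ≤ (3 * (σ ^ 2 + 2 * b ^ 2 + 1) + 1) * (Real.sqrt n *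
      Real.sqrt (Fintype.card S * (1 + M.changeProb * n) * Real.log n)) := by
  have := M.nonempty_state
  set V := σ ^ 2 + 2 * b ^ 2 + 1 with hVdef
  have hV : 0 < V := by positivity
  have hp := M.changeProb_nonneg
  have hcard : (1 : ℝ) ≤ Fintype.card S := by exact_mod_cast Fintype.card_pos (α := S)
  have hn' : (2 : ℝ) ≤ n := by exact_mod_cast hn
  have hlog : 1 / 2 ≤ Real.log n :=
    le_trans (by linarith [Real.log_two_gt_d9]) (Real.log_le_log two_pos hn')
  have hL : 1 ≤ 1 + M.changeProb * n := le_add_of_nonneg_right (by positivity)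
  set K := (Fintype.card S : ℝ) * (1 + M.changeProb * n) * Real.log n with hK
  have hK0 : 0 < K := by positivity
  have hsK : 0 < Real.sqrt K := Real.sqrt_pos.2 hK0
  have hsn : 0 < Real.sqrt n := Real.sqrt_pos.2 (by linarith)
  have hKK : Real.sqrt K * Real.sqrt K = K := Real.mul_self_sqrt hK0.le
  have hnn : Real.sqrt n * Real.sqrt n = n := Real.mul_self_sqrt (by linarith)
  have hprod : 0 < Real.sqrt n * Real.sqrt K := by positivity
  by_cases hS : Fintype.card S ≤ n
  -- This `α` makes both terms multiples of `√n √K`, with coefficients `3 V` and `1 / 2`.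
  · have hα : 0 < Real.sqrt n * Fintype.card S / Real.sqrt K := by positivity
    have h := M.bayesRegret_mTS_le ℓ g hM hb hV (by linarith : σ ^ 2 + 2 * b ^ 2 ≤ V) hα hn hS
    have e1 : Real.sqrt n * Fintype.card S / Real.sqrt K * V *
        (3 * ((1 + M.changeProb * n) * Real.log n)) = 3 * V * (Real.sqrt n * Real.sqrt K) := by
      field_simp
      rw [sq, hKK, hK]
    have e2 : n * (Fintype.card S / (2 * (Real.sqrt n * Fintype.card S / Real.sqrt K))) =
        Real.sqrt n * Real.sqrt K / 2 := by
      field_simp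
      rw [sq, hnn]
    rw [e1, e2] at h
    linarith
  · have hS' : (n : ℝ) ≤ Fintype.card S := by exact_mod_cast (not_le.1 hS).le
    have h1 := M.bayesRegret_le_mul g hb (M.mTS ℓ g) n
    -- With `|S| > n` and `log n ≥ 1/2`, the quantity `K` is itself of order at least `n`, so `√n
    -- √K` dominates the trivial bound.
    have h2 : (n : ℝ) / 4 ≤ K := by
      have : (n : ℝ) * 1 * (1 / 2) ≤ K := by rw [hK]; gcongr
      linarith
    have h3 : Real.sqrt n / 2 ≤ Real.sqrt K := by
      rw [← abs_of_nonneg (by positivity : 0 ≤ Real.sqrt n / 2)]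
      refine Real.abs_le_sqrt ?_
      rw [div_pow, sq, hnn]
      linarith
    have h4 : (n : ℝ) ≤ 2 * (Real.sqrt n * Real.sqrt K) := by nlinarith
    have h5 : 2 * b ≤ 3 * V + 1 := by nlinarith [sq_nonneg (b - 1), sq_nonneg σ, sq_nonneg b]
    have h6 : b ≤ (3 * V + 1) / 2 := by linarith
    calc _ ≤ n * b := h1
      _ ≤ n * ((3 * V + 1) / 2) := by gcongr
      _ ≤ 2 * (Real.sqrt n * Real.sqrt K) * ((3 * V + 1) / 2) := by gcongr
      _ = _ := by ring

end LatentBandit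

/-! ### The main theorem -/

theorem mainTheorem1 (σ b : ℝ) (hσ : 0 ≤ σ) :
    ∃ C : ℝ, 0 < C ∧
      ∀ (A X S : Type*) [Fintype A] [MeasurableSpace A] [DiscreteMeasurableSpace A]
        [MeasurableSpace X] [Fintype S] [MeasurableSpace S] [DiscreteMeasurableSpace S]
        (M : LatentBandit A X S) (ℓ : M.Likelihood) (g : M.GreedyRule),
        M.SubGaussianRewards σ →
        (∀ (x : X) (a a' : A) (s s' : S), M.mean a x s - M.mean a' x s' ≤ b) →
        ∀ n : ℕ, 2 ≤ n →
          M.bayesRegret (M.mTS ℓ g) n ≤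
            C * ((n : ℝ) ^ (2 / 3 : ℝ) *
              Real.sqrt (Fintype.card S * (1 + M.changeProb * n) * Real.log n)) := by
  refine ⟨3 * (σ ^ 2 + 2 * b ^ 2 + 1) + 1, by positivity, ?_⟩
  intro A X S _ _ _ _ _ _ _ M ℓ g hM hb n hn
  refine (M.bayesRegret_mTS_le_sqrt ℓ g hM hb hn).trans ?_
  have hn' : (1 : ℝ) ≤ n := by exact_mod_cast (by omega : 1 ≤ n)
  -- The sharper rate `n ^ (1/2)` is relaxed to the stated exponent.
  have hsqrt : Real.sqrt n ≤ (n : ℝ) ^ (2 / 3 : ℝ) := by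
    rw [Real.sqrt_eq_rpow]
    exact Real.rpow_le_rpow_of_exponent_le hn' (by norm_num)
  gcongr
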